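/- For a topological space $S$, let $D(S)$ be the unbounded derived category of sheaves of abelian groups on $S$, let $D(\mathbb Z)$ be the derived category of abelian groups, and let $\pi_S^{-1}\colon D(\mathbb Z)\to D(S)$ be the (exact) constant sheaf functor, i.e. the inverse image by the projection of $S$ to a point. Whenever $\pi_S^{-1}$ has a left adjoint, denote it by $\mathbb L(S,-)\colon D(S)\to D(\mathbb Z)$ and put $H_i(S,F):=H^{-i}(\mathbb L(S,F))$ for $F\in D(S)$ and $i\in\mathbb Z$. For a continuous map $f\colon S\to T$ between such spaces and $F\in D(T)$, let $f_*\colon H_i(S,f^{-1}F)\to H_i(T,F)$ be induced by the morphism $\mathbb L(S,f^{-1}F)\to\mathbb L(T,F)$ that is adjoint to $f^{-1}$ of the unit, $f^{-1}F\to f^{-1}\pi_T^{-1}\mathbb L(T,F)=\pi_S^{-1}\mathbb L(T,F)$. For a subspace $S$ of $X$ write $F_{|S}$ for the inverse image of $F$ by the inclusion. **Proposition (Mayer–Vietoris for closed subsets).** Let $X$ be a topological space, and let $Y,Z\subseteq X$ be closed subsets with $X=Y\cup Z$, such that for each of the spaces $S=X,\,Y,\,Z,\,Y\cap Z$ the functor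 $\pi_S^{-1}\colon D(\mathbb Z)\to D(S)$ has a left adjoint. Then for every $F\in D(X)$ there are homomorphisms $\delta_i\colon H_{i+1}(X,F)\to H_i(Y\cap Z,F_{|Y\cap Z})$, $i\in\mathbb Z$, such that the sequence $$\cdots\to H_{i+1}(X,F)\xrightarrow{\ \delta_i\ }H_i(Y\cap Z,F_{|Y\cap Z})\xrightarrow{\ \alpha_i\ }H_i(Y,F_{|Y})\oplus H_i(Z,F_{|Z})\xrightarrow{\ \beta_i\ }H_i(X,F)\xrightarrow{\ \delta_{i-1}\ }\cdots$$ is exact, where $\alpha_i(c)=(k_*c,\,-l_*c)$ for the inclusions $k\colon Y\cap Z\to Y$ and $l\colon Y\cap Z\to Z$, and $\beta_i(a,b)=p_*a+q_*b$ for the inclusions $p\colon Y\to X$ and $q\colon Z\to X$. -/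

import Mathlib

open CategoryTheory CategoryTheory.Limits TopologicalSpace

universe w u

namespace SheafHomology

noncomputable section

/-- The category `Shv(X)` of sheaves of abelian groups on a topological space `X`. -/
abbrev Shv (X : TopCat.{u}) : Type (u + 1) := TopCat.Sheaf AddCommGrpCat.{u} X

/-! ### Inverse image of sheaves and constant sheaves -/

/-- The inverse image functor `f⁻¹ : Shv(Y) ⥤ Shv(X)` of a continuous map `f : X ⟶ Y`. -/
abbrev inverseImage {X Y : TopCat.{u}} (f : X ⟶ Y) : Shv Y ⥤ Shv X :=
  TopCat.Sheaf.pullback AddCommGrpCat.{u} f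

/-- The functor `π_X⁻¹ : Mod(ℤ) ⥤ Shv(X)`, sending an abelian group to the constant sheaf on it. -/
def constant (X : TopCat.{u}) : AddCommGrpCat.{u} ⥤ Shv X :=
  constantSheaf (Opens.grothendieckTopology X) AddCommGrpCat.{u}

/-- The functor of global sections `Γ(X, -) : Shv(X) ⥤ Mod(ℤ)`. -/
def globalSections (X : TopCat.{u}) : Shv X ⥤ AddCommGrpCat.{u} :=
  (sheafSections (Opens.grothendieckTopology X) AddCommGrpCat.{u}).obj
    (Opposite.op (⊤ : Opens X))

/-- `π_X⁻¹` is left adjoint to the functor of global sections. -/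
def constantAdj (X : TopCat.{u}) : constant X ⊣ globalSections X :=
  constantSheafAdj _ _ isTerminalTop

instance {X Y : TopCat.{u}} (f : X ⟶ Y) : PreservesFiniteLimits (inverseImage f) :=
  Functor.SmallCategories.instPreservesFiniteLimitsSheafSheafPullbackOfRepresentablyFlat
    (Opens.map f) AddCommGrpCat.{u} (Opens.grothendieckTopology Y) (Opens.grothendieckTopology X)

instance {X Y : TopCat.{u}} (f : X ⟶ Y) : (inverseImage f).Additive :=
  Functor.additive_of_preserves_binary_products _

instance (X : TopCat.{u}) : PreservesFiniteLimits (constant X) := by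
  have h₁ : PreservesFiniteLimits
      (Functor.const (Opens X)ᵒᵖ : AddCommGrpCat.{u} ⥤ (Opens X)ᵒᵖ ⥤ AddCommGrpCat.{u}) := by
    infer_instance
  have h₂ : PreservesFiniteLimits
      (presheafToSheaf (Opens.grothendieckTopology X) AddCommGrpCat.{u}) :=
    HasSheafify.isLeftExact
  exact @comp_preservesFiniteLimits _ _ _ _ _ _ _ _ h₁ h₂

instance (X : TopCat.{u}) : (constant X).IsLeftAdjoint := (constantAdj X).isLeftAdjoint

instance (X : TopCat.{u}) : (constant X).Additive :=
  Functor.additive_of_preserves_binary_products _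

/-- `f⁻¹ g⁻¹ = (g f)⁻¹`: the isomorphism corresponding, by adjunction, to the equality
`(g f)_* = g_* f_*` of direct image functors. -/
def inverseImageComp {X Y Z : TopCat.{u}} (f : X ⟶ Y) (g : Y ⟶ Z) (h : X ⟶ Z) (w : f ≫ g = h) :
    inverseImage g ⋙ inverseImage f ≅ inverseImage h :=
  (((TopCat.Sheaf.pullbackPushforwardAdjunction AddCommGrpCat.{u} g).comp
      (TopCat.Sheaf.pullbackPushforwardAdjunction AddCommGrpCat.{u} f)).ofNatIsoRight
    (eqToIso (by subst w; rfl))).leftAdjointUniq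
    (TopCat.Sheaf.pullbackPushforwardAdjunction AddCommGrpCat.{u} h)

/-- `f⁻¹ π_Y⁻¹ = π_X⁻¹`: the isomorphism corresponding, by adjunction, to the equality
`Γ(Y, f_* -) = Γ(X, -)`. -/
def constantInverseImage {X Y : TopCat.{u}} (f : X ⟶ Y) :
    constant Y ⋙ inverseImage f ≅ constant X :=
  ((constantAdj Y).comp
      (TopCat.Sheaf.pullbackPushforwardAdjunction AddCommGrpCat.{u} f)).leftAdjointUniq
    ((constantAdj X).ofNatIsoRight (Iso.refl _))

/-! ### Exact functors on derived categories -/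

/-- If exact functors satisfy `F ⋙ G ≅ H`, so do the induced functors on derived categories. -/
def derivedComp {A B C : Type (u + 1)} [Category.{u} A] [Abelian A] [Category.{u} B] [Abelian B]
    [Category.{u} C] [Abelian C] [HasDerivedCategory.{w} A] [HasDerivedCategory.{w} B]
    [HasDerivedCategory.{w} C] {F : A ⥤ B} {G : B ⥤ C} {H : A ⥤ C}
    [F.Additive] [PreservesFiniteLimits F] [PreservesFiniteColimits F]
    [G.Additive] [PreservesFiniteLimits G] [PreservesFiniteColimits G]
    [H.Additive] [PreservesFiniteLimits H] [PreservesFiniteColimits H] (e : F ⋙ G ≅ H) :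
    F.mapDerivedCategory ⋙ G.mapDerivedCategory ≅ H.mapDerivedCategory :=
  Localization.liftNatIso DerivedCategory.Q
    (HomologicalComplex.quasiIso A (ComplexShape.up ℤ))
    (DerivedCategory.Q ⋙ F.mapDerivedCategory ⋙ G.mapDerivedCategory)
    (DerivedCategory.Q ⋙ H.mapDerivedCategory) _ _
    (Functor.isoWhiskerRight F.mapDerivedCategoryFactors G.mapDerivedCategory ≪≫
      Functor.isoWhiskerLeft (F.mapHomologicalComplex (ComplexShape.up ℤ))
        G.mapDerivedCategoryFactors ≪≫
      Functor.isoWhiskerRight (NatIso.mapHomologicalComplex e (ComplexShape.up ℤ))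
        DerivedCategory.Q ≪≫
      H.mapDerivedCategoryFactors.symm)

/-! ### Homology of complexes of sheaves -/

section Homology

variable [HasDerivedCategory.{w} AddCommGrpCat.{u}]
  [∀ X : TopCat.{u}, HasDerivedCategory.{w} (Shv X)]

/-- The unbounded derived category `D(X)` of sheaves of abelian groups on `X`. -/
abbrev D (X : TopCat.{u}) := DerivedCategory.{w} (Shv X)

/-- The inverse image functor `f⁻¹ : D(Y) ⥤ D(X)`. -/
abbrev derivedInverseImage {X Y : TopCat.{u}} (f : X ⟶ Y) : D.{w} Y ⥤ D.{w} X :=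
  (inverseImage f).mapDerivedCategory

/-- The functor `π_X⁻¹ : D(ℤ) ⥤ D(X)`. -/
abbrev derivedConstant (X : TopCat.{u}) : DerivedCategory.{w} AddCommGrpCat.{u} ⥤ D.{w} X :=
  (constant X).mapDerivedCategory

/-- The space `X` has a homology theory of sheaves: `π_X⁻¹ : D(ℤ) ⥤ D(X)` has a left adjoint. -/
class HasHomology (X : TopCat.{u}) : Prop where
  isRightAdjoint : (derivedConstant.{w} X).IsRightAdjoint

instance (X : TopCat.{u}) [HasHomology.{w} X] : (derivedConstant.{w} X).IsRightAdjoint :=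
  HasHomology.isRightAdjoint

/-- The functor `𝕃(X, -) : D(X) ⥤ D(ℤ)`, the left adjoint of `π_X⁻¹`. -/
def L (X : TopCat.{u}) [HasHomology.{w} X] : D.{w} X ⥤ DerivedCategory.{w} AddCommGrpCat.{u} :=
  (derivedConstant.{w} X).leftAdjoint

/-- The adjunction `𝕃(X, -) ⊣ π_X⁻¹`. -/
def adjL (X : TopCat.{u}) [HasHomology.{w} X] : L.{w} X ⊣ derivedConstant.{w} X :=
  Adjunction.ofIsRightAdjoint _

/-- The morphism `f_* : 𝕃(X, f⁻¹F) ⟶ 𝕃(Y, F)` of a continuous map `f : X ⟶ Y`: the one that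
corresponds by adjunction to
`f⁻¹F ⟶ f⁻¹ π_Y⁻¹ 𝕃(Y, F) = π_X⁻¹ 𝕃(Y, F)`, the inverse image of the unit. -/
def mapL {X Y : TopCat.{u}} [HasHomology.{w} X] [HasHomology.{w} Y] (f : X ⟶ Y) (F : D.{w} Y) :
    (L X).obj ((derivedInverseImage f).obj F) ⟶ (L Y).obj F :=
  ((adjL X).homEquiv _ _).symm
    ((derivedInverseImage f).map ((adjL Y).unit.app F) ≫
      (derivedComp (constantInverseImage f)).hom.app ((L Y).obj F))

/-- The homology group `H_i(X, F) = H_i(𝕃(X, F)) = H^{-i}(𝕃(X, F))`. -/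
def H (i : ℤ) (X : TopCat.{u}) [HasHomology.{w} X] (F : D.{w} X) : AddCommGrpCat.{u} :=
  (DerivedCategory.homologyFunctor AddCommGrpCat.{u} (-i)).obj ((L X).obj F)

/-- The homomorphism `f_* : H_i(X, f⁻¹F) → H_i(Y, F)`. -/
def pushforward (i : ℤ) {X Y : TopCat.{u}} [HasHomology.{w} X] [HasHomology.{w} Y]
    (f : X ⟶ Y) (F : D.{w} Y) : H i X ((derivedInverseImage f).obj F) ⟶ H i Y F :=
  (DerivedCategory.homologyFunctor AddCommGrpCat.{u} (-i)).map (mapL f F)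

/-! ### Subspaces -/

/-- The inclusion of a subspace `S` of `X`. -/
abbrev incl {X : TopCat.{u}} (S : Set X) : TopCat.of S ⟶ X :=
  TopCat.ofHom ⟨Subtype.val, continuous_subtype_val⟩

/-- The inclusion of a subspace `S` of `X` in a bigger subspace `T`. -/
abbrev inclOfSubset {X : TopCat.{u}} {S T : Set X} (h : S ⊆ T) : TopCat.of S ⟶ TopCat.of T :=
  TopCat.ofHom ⟨Set.inclusion h, continuous_inclusion h⟩

/-- The restriction `F|_S` of `F ∈ D(X)` to a subspace `S`. -/
abbrev restrict {X : TopCat.{u}} (S : Set X) (F : D.{w} X) : D.{w} (TopCat.of S) :=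
  (derivedInverseImage (incl S)).obj F

/-- For `S ⊆ T ⊆ X`, restricting `F` to `T` and then to `S` gives `F|_S`. -/
def restrictIso {X : TopCat.{u}} {S T : Set X} (h : S ⊆ T) (F : D.{w} X) :
    (derivedInverseImage (inclOfSubset h)).obj (restrict T F) ≅ restrict S F :=
  (derivedComp (inverseImageComp (inclOfSubset h) (incl T) (incl S) rfl)).app F

/-- For `S ⊆ T ⊆ X`, the homomorphism `H_i(S, F|_S) → H_i(T, F|_T)` induced by the inclusion. -/
def fromSubset (i : ℤ) {X : TopCat.{u}} {S T : Set X} (h : S ⊆ T)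
    [HasHomology.{w} (TopCat.of S)] [HasHomology.{w} (TopCat.of T)] (F : D.{w} X) :
    H i (TopCat.of S) (restrict S F) ⟶ H i (TopCat.of T) (restrict T F) :=
  (DerivedCategory.homologyFunctor AddCommGrpCat.{u} (-i)).map
      ((L (TopCat.of S)).map (restrictIso h F).inv) ≫
    pushforward i (inclOfSubset h) (restrict T F)

/-- For `S ⊆ X`, the homomorphism `H_i(S, F|_S) → H_i(X, F)` induced by the inclusion. -/
def fromSubspace (i : ℤ) {X : TopCat.{u}} (S : Set X)
    [HasHomology.{w} (TopCat.of S)] [HasHomology.{w} X] (F : D.{w} X) :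
    H i (TopCat.of S) (restrict S F) ⟶ H i X F :=
  pushforward i (incl S) F

end Homology

end

end SheafHomology

/-! For a closed subset `S` with inclusion `i_S`, write `G_S` for `i_S* i_S⁻¹ G`. The sequence `0 ⟶
G ⟶ G_Y ⊞ G_Z ⟶ G_{Y ∩ Z} ⟶ 0` is exact (`mayerVietorisComplex_shortExact`). Direct image along a
closed inclusion is exact, so all these functors pass termwise to derived categories, and the
sequence yields a distinguished triangle in `D(X)` whose connecting morphism is natural in `G`
(`mayerVietorisδ`).

Take `G = π_X⁻¹ M`. The adjunctions identify `Hom(F, G_S)` with `Hom(𝕃(S, F|_S), M)`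
(`supportEquiv`), and by `supportEquiv_mapL_comp` and `supportEquiv_subsetL_comp` the maps of the
triangle become precomposition with the morphisms induced by inclusions. In Yoneda fashion, the
identity of `𝕃(Y ∩ Z, F|_{Y ∩ Z})` produces `connectingL`, and `Hom(-, M)` is exact on `𝕃(Y ∩ Z) ⟶
𝕃(Y) ⊞ 𝕃(Z) ⟶ 𝕃(X) ⟶ 𝕃(Y ∩ Z)⟦1⟧` for every `M`.

This sequence need not be shown to be a distinguished triangle. For `M` an injective group `I` in
degree `n`, `Hom(K, M)` is `Hom(Hⁿ K, I)` (`eq_zero_of_homologyFunctor_map_eq_zero`,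
`exists_homologyFunctor_map_eq`). Maps to injective groups separate a subgroup from any element
outside it, so exactness of `Hom(-, M)` forces exactness of homology (`homology_exact_connecting`,
`homology_exact_middle`, `homology_exact_last`). -/

namespace SheafHomology

noncomputable section

/-! ### Comparison of the monads of two adjunctions -/

section Compare

universe v₁ v₂ v₃ u₁ u₂ u₃

variable {C : Type u₁} [Category.{v₁} C] {D : Type u₂} [Category.{v₂} D] {E : Type u₃}
  [Category.{v₃} E] {P : C ⥤ D} {R : D ⥤ C} (adj : P ⊣ R) {P' : C ⥤ E} {R' : E ⥤ C}
  (adj' : P' ⊣ R') {K : D ⥤ E} (c : P ⋙ K ≅ P')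

/-- If `P' ≅ P ⋙ K`, the comparison from the monad of `P ⊣ R` to the monad of `P' ⊣ R'`. -/
def monadCompare : P ⋙ R ⟶ P' ⋙ R' where
  app G := adj'.homEquiv _ _
    (c.inv.app (R.obj (P.obj G)) ≫ K.map (adj.counit.app (P.obj G)) ≫ c.hom.app G)
  naturality G H f := by
    rw [Functor.comp_map, Functor.comp_map, ← adj'.homEquiv_naturality_left,
      ← adj'.homEquiv_naturality_right]
    congr 1
    have h₁ := c.inv.naturality (R.map (P.map f))
    have h₂ := c.hom.naturality f
    have h₃ := adj.counit.naturality (P.map f)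
    simp only [Functor.comp_map, Functor.id_map, Functor.comp_obj, Functor.id_obj,
      Category.assoc] at h₁ h₂ h₃ ⊢
    rw [reassoc_of% h₁, ← h₂, ← Functor.map_comp_assoc, ← Functor.map_comp_assoc, h₃]

lemma unit_monadCompare (G : C) :
    adj.unit.app G ≫ (monadCompare adj adj' c).app G = adj'.unit.app G := by
  apply (adj'.homEquiv _ _).symm.injective
  rw [monadCompare, adj'.homEquiv_naturality_left_symm, Equiv.symm_apply_apply]
  have h₁ := c.inv.naturality (adj.unit.app G)
  simp only [Functor.comp_map, Functor.id_obj, Functor.comp_obj] at h₁ ⊢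
  rw [reassoc_of% h₁, ← Functor.map_comp_assoc, adj.left_triangle_components]
  simp

-- The triangle identity makes `P` invert the unit once the counit is invertible at `P.obj G`; `P'`
-- factors through `P`.
include c in
lemma isIso_map_unit_of_isIso_counit (G : C) [IsIso (adj.counit.app (P.obj G))] :
    IsIso (P'.map (adj.unit.app G)) := by
  have h : IsIso (P.map (adj.unit.app G)) := by
    rw [show P.map (adj.unit.app G) = inv (adj.counit.app (P.obj G)) from
      (IsIso.inv_eq_of_inv_hom_id (adj.left_triangle_components G)).symm]
    infer_instance
  rw [← NatIso.naturality_1 c]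
  dsimp only [Functor.comp_map]
  infer_instance

/-- `P'` inverts the unit of `adj`, so a map into an object `R'.obj _` is determined by its
composite with that unit. This recognises a comparison constructed by other means, such as
localization. -/
lemma eq_monadCompare {G : C} [IsIso (adj.counit.app (P.obj G))]
    (r : R.obj (P.obj G) ⟶ R'.obj (P'.obj G))
    (hr : adj.unit.app G ≫ r = adj'.unit.app G) : r = (monadCompare adj adj' c).app G := by
  have := isIso_map_unit_of_isIso_counit adj c G
  rw [← unit_monadCompare adj adj' c G] at hr
  apply (adj'.homEquiv _ _).symm.injective
  rw [← cancel_epi (P'.map (adj.unit.app G))]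
  dsimp only [Functor.id_obj, Functor.comp_obj]
  rw [← adj'.homEquiv_naturality_left_symm, ← adj'.homEquiv_naturality_left_symm]
  exact congrArg _ hr

/-- The morphism `y` need not come from `C`, so naturality of `monadCompare` is not enough. This is
the input for comparing `supportEquiv` on two nested subspaces. -/
lemma unit_map_comp {F G : C} [IsIso (adj.counit.app (P.obj G))]
    (r : R.obj (P.obj G) ⟶ R'.obj (P'.obj G))
    (hr : adj.unit.app G ≫ r = adj'.unit.app G) (y : P.obj F ⟶ P.obj G) :
    adj.unit.app F ≫ R.map y ≫ r =
      adj'.unit.app F ≫ R'.map (c.inv.app F ≫ K.map y ≫ c.hom.app G) := by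
  rw [eq_monadCompare adj adj' c r hr]
  refine Eq.trans ?_ (adj'.homEquiv_unit F (P'.obj G) _)
  apply (adj'.homEquiv _ _).symm.injective
  refine Eq.trans ?_ (Equiv.symm_apply_apply _ _).symm
  have h₀ : (adj'.homEquiv _ _).symm ((monadCompare adj adj' c).app G) = c.inv.app _ ≫ K.map
      (adj.counit.app (P.obj G)) ≫ c.hom.app G := Equiv.symm_apply_apply _ _
  rw [← Category.assoc, adj'.homEquiv_naturality_left_symm]
  refine (congrArg (_ ≫ ·) h₀).trans ?_
  have h₁ := c.inv.naturality (adj.unit.app F ≫ R.map y)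
  have h₂ := adj.counit.naturality y
  simp only [Functor.comp_map, Functor.id_obj, Functor.comp_obj, Functor.id_map] at h₁ h₂ ⊢
  rw [reassoc_of% h₁, ← Functor.map_comp_assoc, P.map_comp, Category.assoc, h₂,
    adj.left_triangle_components_assoc]

end Compare

/-! ### Split bicartesian squares -/

section Square

universe v₁ v₂ u₁ u₂

variable {A : Type u₁} [Category.{v₁} A] [Abelian A]
  {B : Type u₂} [Category.{v₂} B] [Abelian B]

/-- The complex `X ⟶ Y ⊞ Z ⟶ W` of a commutative square. -/
def squareComplex {X Y Z W : A} (a : X ⟶ Y) (b : X ⟶ Z) (c : Y ⟶ W) (d : Z ⟶ W)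
    (h : a ≫ c = b ≫ d) : ShortComplex A where
  f := biprod.lift a b
  g := biprod.desc c (-d)
  zero := by simp [h]

/-- Inverting `a` and `d` gives an explicit splitting. The biproduct enters through equations
because `M` will be the image of a biproduct under an additive functor. -/
lemma shortExact_of_isIso_left {X Y Z W M : A} {a : X ⟶ Y} {b : X ⟶ Z} {c : Y ⟶ W} {d : Z ⟶ W}
    (h : a ≫ c = b ≫ d) [IsIso a] [IsIso d] {i : Y ⟶ M} {j : Z ⟶ M} {p : M ⟶ Y} {q : M ⟶ Z}
    (hip : i ≫ p = 𝟙 _) (hjp : j ≫ p = 0) (hjq : j ≫ q = 𝟙 _)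
    (hM : p ≫ i + q ≫ j = 𝟙 M)
    {f : X ⟶ M} {g : M ⟶ W} (hf : f = a ≫ i + b ≫ j) (hg : g = p ≫ c - q ≫ d) (w : f ≫ g = 0) :
    (ShortComplex.mk f g w).ShortExact := by
  subst hf hg
  have h' : inv a ≫ b = c ≫ inv d := by
    rw [IsIso.inv_comp_eq, ← Category.assoc, h, Category.assoc, IsIso.hom_inv_id,
      Category.comp_id]
  exact ShortComplex.Splitting.shortExact
    { r := p ≫ inv a
      s := - (inv d ≫ j)
      f_r := by simp [reassoc_of% hip, reassoc_of% hjp]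
      s_g := by simp [reassoc_of% hjp, reassoc_of% hjq]
      id := by
        dsimp only
        rw [← hM]
        simp only [Preadditive.comp_add, Preadditive.comp_neg, Preadditive.sub_comp,
          Category.assoc, IsIso.inv_hom_id_assoc, IsIso.hom_inv_id_assoc]
        rw [reassoc_of% h']
        abel }

lemma shortExact_of_isIso_right {X Y Z W M : A} {a : X ⟶ Y} {b : X ⟶ Z} {c : Y ⟶ W} {d : Z ⟶ W}
    (h : a ≫ c = b ≫ d) [IsIso b] [IsIso c] {i : Y ⟶ M} {j : Z ⟶ M} {p : M ⟶ Y} {q : M ⟶ Z}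
    (hip : i ≫ p = 𝟙 _) (hiq : i ≫ q = 0) (hjq : j ≫ q = 𝟙 _)
    (hM : p ≫ i + q ≫ j = 𝟙 M)
    {f : X ⟶ M} {g : M ⟶ W} (hf : f = a ≫ i + b ≫ j) (hg : g = p ≫ c - q ≫ d) (w : f ≫ g = 0) :
    (ShortComplex.mk f g w).ShortExact := by
  subst hf hg
  have h' : inv b ≫ a = d ≫ inv c := by
    rw [IsIso.inv_comp_eq, ← Category.assoc, ← h, Category.assoc, IsIso.hom_inv_id,
      Category.comp_id]
  exact ShortComplex.Splitting.shortExact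
    { r := q ≫ inv b
      s := inv c ≫ i
      f_r := by simp [reassoc_of% hiq, reassoc_of% hjq]
      s_g := by simp [reassoc_of% hiq, reassoc_of% hip]
      id := by
        dsimp only
        rw [← hM]
        simp only [Preadditive.comp_add, Preadditive.sub_comp,
          Category.assoc, IsIso.inv_hom_id_assoc, IsIso.hom_inv_id_assoc]
        rw [reassoc_of% h']
        abel }

/-- The complex of a commutative square becomes short exact after applying an additive functor
that inverts two opposite sides of the square. -/
lemma shortExact_map_squareComplex (P : A ⥤ B) [P.Additive] {X Y Z W : A} {a : X ⟶ Y} {b : X ⟶ Z}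
    {c : Y ⟶ W} {d : Z ⟶ W} (h : a ≫ c = b ≫ d)
    (hP : (IsIso (P.map a) ∧ IsIso (P.map d)) ∨ (IsIso (P.map b) ∧ IsIso (P.map c))) :
    ((squareComplex a b c d h).map P).ShortExact := by
  have h' : P.map a ≫ P.map c = P.map b ≫ P.map d := by rw [← P.map_comp, h, P.map_comp]
  have hM : P.map (biprod.fst : Y ⊞ Z ⟶ Y) ≫ P.map biprod.inl +
      P.map (biprod.snd : Y ⊞ Z ⟶ Z) ≫ P.map biprod.inr = 𝟙 _ := by
    rw [← P.map_comp, ← P.map_comp, ← P.map_add, biprod.total, P.map_id]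
  have hf : P.map (biprod.lift a b) = P.map a ≫ P.map biprod.inl + P.map b ≫ P.map biprod.inr := by
    rw [← P.map_comp, ← P.map_comp, ← P.map_add, biprod.lift_eq]
  have hg : P.map (biprod.desc c (-d)) =
      P.map biprod.fst ≫ P.map c - P.map biprod.snd ≫ P.map d := by
    rw [← P.map_comp, ← P.map_comp, ← P.map_sub, biprod.desc_eq]
    simp [sub_eq_add_neg]
  have h₁ : P.map (biprod.inl : Y ⟶ Y ⊞ Z) ≫ P.map biprod.fst = 𝟙 _ := by simp [← P.map_comp]
  have h₂ : P.map (biprod.inl : Y ⟶ Y ⊞ Z) ≫ P.map biprod.snd = 0 := by simp [← P.map_comp]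
  have h₃ : P.map (biprod.inr : Z ⟶ Y ⊞ Z) ≫ P.map biprod.fst = 0 := by simp [← P.map_comp]
  have h₄ : P.map (biprod.inr : Z ⟶ Y ⊞ Z) ≫ P.map biprod.snd = 𝟙 _ := by simp [← P.map_comp]
  obtain ⟨_, _⟩ | ⟨_, _⟩ := hP
  · exact shortExact_of_isIso_left h' h₁ h₃ h₄ hM hf hg _
  · exact shortExact_of_isIso_right h' h₁ h₂ h₄ hM hf hg _

end Square

/-! ### Direct images of sheaves -/

/-- The direct image functor `f_* : Shv(X) ⥤ Shv(Y)` of a continuous map `f : X ⟶ Y`. -/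
abbrev directImage {X Y : TopCat.{u}} (f : X ⟶ Y) : Shv X ⥤ Shv Y :=
  TopCat.Sheaf.pushforward AddCommGrpCat.{u} f

/-- The adjunction `f⁻¹ ⊣ f_*`. -/
abbrev imageAdj {X Y : TopCat.{u}} (f : X ⟶ Y) : inverseImage f ⊣ directImage f :=
  TopCat.Sheaf.pullbackPushforwardAdjunction AddCommGrpCat.{u} f

instance {X Y : TopCat.{u}} (f : X ⟶ Y) : PreservesFiniteLimits (directImage f) := by
  have : PreservesLimitsOfSize.{0, 0} (directImage f) := (imageAdj f).rightAdjoint_preservesLimits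
  infer_instance

instance {X Y : TopCat.{u}} (f : X ⟶ Y) : (directImage f).Additive :=
  Functor.additive_of_preserves_binary_products _

/-- The skyscraper at `f x` is the direct image of the skyscraper at `x`, so maps out of the stalk
of `G` at `f x` correspond to maps out of `f⁻¹ G`. -/
theorem isZero_stalk_of_isZero_inverseImage {X Y : TopCat.{u}} (f : X ⟶ Y) (G : Shv Y)
    (h : IsZero ((inverseImage f).obj G)) (x : X) :
    IsZero ((TopCat.Sheaf.forget AddCommGrpCat.{u} Y ⋙
      TopCat.Presheaf.stalkFunctor _ (f x)).obj G) := by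
  classical
  rw [IsZero.iff_id_eq_zero]
  apply ((stalkSkyscraperSheafAdjunction (f x)).homEquiv _ _).injective
  apply ((imageAdj f).homEquiv G ((skyscraperSheafFunctor x).obj _)).symm.injective
  exact h.eq_of_src _ _

/-- Vanishing is tested on stalks, so the images of the `j` only have to cover `X` as a set; they
need not be open. -/
theorem isZero_of_isZero_inverseImage {X : TopCat.{u}} (G : Shv X)
    (h : ∀ x : X, ∃ (S : TopCat.{u}) (j : S ⟶ X), x ∈ Set.range j ∧
      IsZero ((inverseImage j).obj G)) : IsZero G := by
  rw [TopCat.Sheaf.isZero_iff_stalkFunctor_obj_isZero]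
  intro x
  obtain ⟨S, j, ⟨s, rfl⟩, hj⟩ := h x
  exact isZero_stalk_of_isZero_inverseImage j G hj s

theorem epi_of_epi_inverseImage {X : TopCat.{u}} {G H : Shv X} (φ : G ⟶ H)
    (h : ∀ x : X, ∃ (S : TopCat.{u}) (j : S ⟶ X), x ∈ Set.range j ∧
      Epi ((inverseImage j).map φ)) : Epi φ := by
  apply Preadditive.epi_of_isZero_cokernel
  apply isZero_of_isZero_inverseImage
  intro x
  obtain ⟨S, j, hx, hj⟩ := h x
  exact ⟨S, j, hx, (isZero_cokernel_of_epi _).of_iso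
    (PreservesCokernel.iso (inverseImage j) φ)⟩

theorem mono_of_mono_inverseImage {X : TopCat.{u}} {G H : Shv X} (φ : G ⟶ H)
    (h : ∀ x : X, ∃ (S : TopCat.{u}) (j : S ⟶ X), x ∈ Set.range j ∧
      Mono ((inverseImage j).map φ)) : Mono φ := by
  apply Preadditive.mono_of_isZero_kernel
  apply isZero_of_isZero_inverseImage
  intro x
  obtain ⟨S, j, hx, hj⟩ := h x
  exact ⟨S, j, hx, (isZero_kernel_of_mono _).of_iso
    (PreservesKernel.iso (inverseImage j) φ)⟩

/-- Inverse images are exact, hence commute with kernels, cokernels and homology, whose vanishing is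
detected by a covering family of maps. -/
theorem shortExact_of_shortExact_inverseImage {X : TopCat.{u}} (S : ShortComplex (Shv X))
    (h : ∀ x : X, ∃ (T : TopCat.{u}) (j : T ⟶ X), x ∈ Set.range j ∧
      (S.map (inverseImage j)).ShortExact) : S.ShortExact where
  mono_f := mono_of_mono_inverseImage _ fun x ↦ by
    obtain ⟨S, j, hx, hj⟩ := h x
    exact ⟨S, j, hx, hj.mono_f⟩
  epi_g := epi_of_epi_inverseImage _ fun x ↦ by
    obtain ⟨S, j, hx, hj⟩ := h x
    exact ⟨S, j, hx, hj.epi_g⟩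
  exact := by
    rw [ShortComplex.exact_iff_isZero_homology]
    apply isZero_of_isZero_inverseImage
    intro x
    obtain ⟨T, j, hx, hj⟩ := h x
    refine ⟨T, j, hx, ?_⟩
    have := hj.exact
    rw [ShortComplex.exact_iff_isZero_homology] at this
    exact this.of_iso (S.mapHomologyIso (inverseImage j)).symm

/-- By adjunction, it suffices that any two maps `f_* H ⟶ j_* j⁻¹ f_* H` agree. Shrinking `V` to `V
⊓ U` does not change its preimage under `j`, hence not the sections of the target, while the
sections of the source over `V ⊓ U` are those of `H` over the empty set. -/
theorem isZero_inverseImage_directImage {S T X : TopCat.{u}} (f : S ⟶ X) (j : T ⟶ X)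
    (U : Opens X) (hf : ∀ s, f s ∉ U) (hj : ∀ t, j t ∈ U) (H : Shv S) :
    IsZero ((inverseImage j).obj ((directImage f).obj H)) := by
  rw [IsZero.iff_id_eq_zero]
  apply ((imageAdj j).homEquiv _ _).injective
  generalize (imageAdj j).homEquiv _ _ (𝟙 _) = φ
  generalize (imageAdj j).homEquiv _ _ 0 = ψ
  apply CategoryTheory.Sheaf.hom_ext
  apply NatTrans.ext
  funext V
  have hV : (Opens.map j).obj V.unop = (Opens.map j).obj (V.unop ⊓ U) := by
    ext t
    simp [hj t]
  have e : (Opens.map f).obj (V.unop ⊓ U) = ⊥ := by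
    ext s
    simp [hf s]
  let i : V.unop ⊓ U ⟶ V.unop := homOfLE inf_le_left
  have : IsIso ((Opens.map j).map i) := ⟨eqToHom hV, Subsingleton.elim _ _, Subsingleton.elim _ _⟩
  have : Mono (((directImage j).obj ((inverseImage j).obj ((directImage f).obj H))).obj.map i.op) :=
    inferInstanceAs (Mono (((inverseImage j).obj ((directImage f).obj H)).obj.map
      ((Opens.map j).map i).op))
  rw [← cancel_mono (((directImage j).obj
    ((inverseImage j).obj ((directImage f).obj H))).obj.map i.op)]
  rw [← φ.hom.naturality, ← ψ.hom.naturality]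
  congr 1
  have hz : IsZero (((directImage f).obj H).obj.obj (Opposite.op (V.unop ⊓ U))) :=
    (isZero_zero _).of_iso ((H.isTerminalOfEqEmpty e).uniqueUpToIso (isZero_zero _).isTerminal)
  exact hz.eq_of_src _ _

lemma fullyFaithful_functor {X Y : TopCat.{u}} {f : X ⟶ Y} (hf : Topology.IsInducing f) :
    hf.functor.Full ∧ hf.functor.Faithful := by
  refine ⟨⟨fun {U V} g ↦ ⟨homOfLE ?_, Subsingleton.elim _ _⟩⟩, ⟨fun _ ↦ Subsingleton.elim _ _⟩⟩
  rw [← hf.map_functorObj U, ← hf.map_functorObj V]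
  exact leOfHom ((Opens.map f).map g)

/-- For an inducing map, `Opens.map f` has a fully faithful right adjoint and is therefore a
localization functor; direct image is precomposition with it. -/
lemma full_faithful_directImage {X Y : TopCat.{u}} (f : X ⟶ Y) (hf : Topology.IsInducing f) :
    (directImage f).Full ∧ (directImage f).Faithful := by
  have := (fullyFaithful_functor hf).1
  have := (fullyFaithful_functor hf).2
  have := hf.adjunction.isLocalization
  let W := ((MorphismProperty.isomorphisms (Opens X)).inverseImage (Opens.map f)).op
  have h₁ := Localization.full_whiskeringLeft (Opens.map f).op W AddCommGrpCat.{u}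
  have h₂ := Localization.faithful_whiskeringLeft (Opens.map f).op W AddCommGrpCat.{u}
  refine ⟨⟨fun {G H} φ ↦ ?_⟩, ⟨fun {G H} φ ψ h ↦ ?_⟩⟩
  · obtain ⟨ψ, hψ⟩ := h₁.map_surjective φ.hom
    exact ⟨⟨ψ⟩, CategoryTheory.Sheaf.hom_ext hψ⟩
  · apply CategoryTheory.Sheaf.hom_ext
    exact h₂.map_injective (congrArg (fun x ↦ x.hom) h)

lemma isIso_counit {X Y : TopCat.{u}} (f : X ⟶ Y) (hf : Topology.IsInducing f) :
    IsIso (imageAdj f).counit := by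
  have := (full_faithful_directImage f hf).1
  have := (full_faithful_directImage f hf).2
  infer_instance

instance isIso_counit_incl {X : TopCat.{u}} (S : Set X) : IsIso (imageAdj (incl S)).counit :=
  isIso_counit _ .subtypeVal

/-- Tested on `S`, where the counit identifies `i⁻¹ i_* φ` with `φ`, and on the open complement,
where the target vanishes. -/
theorem directImage_map_epi {X : TopCat.{u}} {S : Set X} (hS : IsClosed S)
    {G H : Shv (TopCat.of S)} (φ : G ⟶ H) [Epi φ] : Epi ((directImage (incl S)).map φ) := by
  apply epi_of_epi_inverseImage
  intro x
  by_cases hx : x ∈ S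
  · refine ⟨_, incl S, ⟨⟨x, hx⟩, rfl⟩, ?_⟩
    have h := NatIso.naturality_2 (asIso (imageAdj (incl S)).counit) φ
    dsimp only [Functor.comp_map, Functor.id_map] at h
    rw [← h]
    infer_instance
  · refine ⟨_, incl Sᶜ, ⟨⟨x, hx⟩, rfl⟩, ?_⟩
    have := isZero_inverseImage_directImage (incl S) (incl Sᶜ) ⟨Sᶜ, hS.isOpen_compl⟩
      (fun s h ↦ h s.2) (fun t ↦ t.2) H
    exact ⟨fun _ _ _ ↦ this.eq_of_src _ _⟩

/-- With left exactness this makes `i_*` exact, so it acts on unbounded derived categories without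
resolutions. The `Fact` lets instance search find closedness. -/
instance {X : TopCat.{u}} (S : Set X) [hS : Fact (IsClosed S)] :
    PreservesFiniteColimits (directImage (incl S)) := by
  have : (directImage (incl S)).PreservesEpimorphisms :=
    ⟨fun φ _ ↦ directImage_map_epi hS.out φ⟩
  have := (directImage (incl S)).preservesHomology_of_preservesEpis_and_kernels
  exact (directImage (incl S)).preservesFiniteColimits_of_preservesHomology

/-! ### Adjunctions between categories of complexes -/

section MapComplex

universe v₁ v₂ u₁ u₂

variable {A : Type u₁} [Category.{v₁} A] [Abelian A]
  {B : Type u₂} [Category.{v₂} B] [Abelian B] {P : A ⥤ B} {R : B ⥤ A} [P.Additive] [R.Additive]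

/-- An adjunction of additive functors induces one between the categories of complexes. -/
def mapComplexAdj (adj : P ⊣ R) :
    P.mapHomologicalComplex (ComplexShape.up ℤ) ⊣ R.mapHomologicalComplex (ComplexShape.up ℤ) where
  unit :=
    { app K := { f n := adj.unit.app (K.X n), comm' i j _ := (adj.unit.naturality (K.d i j)).symm }
      naturality K L φ := by
        ext n : 1
        exact adj.unit.naturality (φ.f n) }
  counit :=
    { app K :=
        { f n := adj.counit.app (K.X n), comm' i j _ := (adj.counit.naturality (K.d i j)).symm }
      naturality K L φ := by
        ext n : 1
        exact adj.counit.naturality (φ.f n) }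
  left_triangle_components K := by
    ext n : 1
    exact adj.left_triangle_components (K.X n)
  right_triangle_components K := by
    ext n : 1
    exact adj.right_triangle_components (K.X n)

end MapComplex

/-! ### The Mayer-Vietoris sequence of sheaves -/

section MayerVietoris

variable {X : TopCat.{u}}

/-- The functor `F ↦ i_* i⁻¹ F` for the inclusion `i` of a subspace. -/
abbrev support (S : Set X) : Shv X ⥤ Shv X := inverseImage (incl S) ⋙ directImage (incl S)

/-- For `S ⊆ T`, the restriction morphism from `i_* i⁻¹ F` for `T` to the one for `S`. -/
def supportMap {S T : Set X} (h : S ⊆ T) : support T ⟶ support S :=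
  monadCompare (imageAdj (incl T)) (imageAdj (incl S))
    (inverseImageComp (inclOfSubset h) (incl T) (incl S) rfl)

lemma unit_supportMap {S T : Set X} (h : S ⊆ T) (G : Shv X) :
    (imageAdj (incl T)).unit.app G ≫ (supportMap h).app G = (imageAdj (incl S)).unit.app G :=
  unit_monadCompare _ _ _ G

lemma isIso_inverseImage_map_unit {S T : Set X} (h : S ⊆ T) (G : Shv X) :
    IsIso ((inverseImage (incl S)).map ((imageAdj (incl T)).unit.app G)) :=
  isIso_map_unit_of_isIso_counit (imageAdj (incl T))
    (inverseImageComp (inclOfSubset h) (incl T) (incl S) rfl) G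

lemma isZero_inverseImage_support {S T : Set X} (hT : IsClosed T) (h : Disjoint S T) (G : Shv X) :
    IsZero ((inverseImage (incl S)).obj ((support T).obj G)) :=
  isZero_inverseImage_directImage (incl T) (incl S) ⟨Tᶜ, hT.isOpen_compl⟩
    (fun s h ↦ h s.2) (fun t ↦ Set.disjoint_left.1 h t.2) _

/-- After restriction to a neighbourhood of any point, two opposite sides of the Mayer-Vietoris
square are isomorphisms. -/
lemma exists_isIso_inverseImage {Y Z : Set X} (hY : IsClosed Y) (hZ : IsClosed Z)
    (hYZ : Y ∪ Z = Set.univ) (x : X) : ∃ (S : Set X), x ∈ S ∧ ∀ G : Shv X,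
      (IsIso ((inverseImage (incl S)).map ((imageAdj (incl Y)).unit.app G)) ∧
        IsIso ((inverseImage (incl S)).map
          ((supportMap (Set.inter_subset_right : Y ∩ Z ⊆ Z)).app G))) ∨
      (IsIso ((inverseImage (incl S)).map ((imageAdj (incl Z)).unit.app G)) ∧
        IsIso ((inverseImage (incl S)).map
          ((supportMap (Set.inter_subset_left : Y ∩ Z ⊆ Y)).app G))) := by
  by_cases h₁ : x ∈ Y
  · by_cases h₂ : x ∈ Z
    -- At a common point no open neighbourhood is needed: restricted to the subspace `Y ∩ Z`, the
    -- unit for `Y` and the restriction map from `Z` are invertible.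
    · refine ⟨Y ∩ Z, ⟨h₁, h₂⟩, fun G ↦ Or.inl ⟨?_, ?_⟩⟩
      · exact isIso_inverseImage_map_unit Set.inter_subset_left G
      · have := isIso_inverseImage_map_unit (Set.inter_subset_right : Y ∩ Z ⊆ Z) G
        have := isIso_inverseImage_map_unit (Set.Subset.refl (Y ∩ Z)) G
        have h := unit_supportMap (Set.inter_subset_right : Y ∩ Z ⊆ Z) G
        have : IsIso ((inverseImage (incl (Y ∩ Z))).map ((imageAdj (incl Z)).unit.app G) ≫
            (inverseImage (incl (Y ∩ Z))).map
              ((supportMap (Set.inter_subset_right : Y ∩ Z ⊆ Z)).app G)) := by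
          rw [← Functor.map_comp, h]
          infer_instance
        exact IsIso.of_isIso_comp_left ((inverseImage (incl (Y ∩ Z))).map
          ((imageAdj (incl Z)).unit.app G)) _
    · refine ⟨Zᶜ, h₂, fun G ↦ Or.inl ⟨?_, ?_⟩⟩
      · refine isIso_inverseImage_map_unit (fun y hy ↦ ?_) G
        exact (hYZ.ge (Set.mem_univ y)).resolve_right hy
      -- Off `Z` both source and target vanish, so the zero morphism is the inverse.
      · refine ⟨0, (isZero_inverseImage_support hZ ?_ G).eq_of_src _ _,
          (isZero_inverseImage_support (hY.inter hZ) ?_ G).eq_of_src _ _⟩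
        · exact disjoint_compl_left
        · exact disjoint_compl_left.mono_right Set.inter_subset_right
  · refine ⟨Yᶜ, h₁, fun G ↦ Or.inr ⟨?_, ?_⟩⟩
    · refine isIso_inverseImage_map_unit (fun y hy ↦ ?_) G
      exact (hYZ.ge (Set.mem_univ y)).resolve_left hy
    · refine ⟨0, (isZero_inverseImage_support hY ?_ G).eq_of_src _ _,
        (isZero_inverseImage_support (hY.inter hZ) ?_ G).eq_of_src _ _⟩
      · exact disjoint_compl_left
      · exact disjoint_compl_left.mono_right Set.inter_subset_left

/-- The functor `F ↦ i_* i⁻¹ F` on complexes of sheaves. -/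
abbrev complexSupport (S : Set X) :
    CochainComplex (Shv X) ℤ ⥤ CochainComplex (Shv X) ℤ :=
  (inverseImage (incl S)).mapHomologicalComplex (ComplexShape.up ℤ) ⋙
    (directImage (incl S)).mapHomologicalComplex (ComplexShape.up ℤ)

/-- The restriction morphism `supportMap` for complexes of sheaves. -/
def complexSupportMap {S T : Set X} (h : S ⊆ T) : complexSupport T ⟶ complexSupport S where
  app K :=
    { f n := (supportMap h).app (K.X n), comm' i j _ := ((supportMap h).naturality (K.d i j)).symm }
  naturality K L φ := by
    ext n : 1
    exact (supportMap h).naturality (φ.f n)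

lemma unit_complexSupportMap {S T : Set X} (h : S ⊆ T) (K : CochainComplex (Shv X) ℤ) :
    (mapComplexAdj (imageAdj (incl T))).unit.app K ≫ (complexSupportMap h).app K =
      (mapComplexAdj (imageAdj (incl S))).unit.app K := by
  ext n : 1
  exact unit_supportMap h (K.X n)

/-- The Mayer-Vietoris sequence of a complex of sheaves:
`0 ⟶ K ⟶ K_Y ⊞ K_Z ⟶ K_{Y ∩ Z} ⟶ 0`. -/
def mayerVietorisComplex (Y Z : Set X) (K : CochainComplex (Shv X) ℤ) :
    ShortComplex (CochainComplex (Shv X) ℤ) :=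
  squareComplex
    ((mapComplexAdj (imageAdj (incl Y))).unit.app K)
    ((mapComplexAdj (imageAdj (incl Z))).unit.app K)
    ((complexSupportMap (Set.inter_subset_left : Y ∩ Z ⊆ Y)).app K)
    ((complexSupportMap (Set.inter_subset_right : Y ∩ Z ⊆ Z)).app K)
    ((unit_complexSupportMap _ _).trans (unit_complexSupportMap _ _).symm)

/-- Exactness is checked in each degree after restriction to the subspaces of
`exists_isIso_inverseImage`; there two opposite sides of the square become invertible, so the
sequence splits. -/
lemma mayerVietorisComplex_shortExact {Y Z : Set X} (hY : IsClosed Y) (hZ : IsClosed Z)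
    (hYZ : Y ∪ Z = Set.univ) (K : CochainComplex (Shv X) ℤ) :
    (mayerVietorisComplex Y Z K).ShortExact := by
  refine HomologicalComplex.shortExact_of_degreewise_shortExact _ fun n ↦ ?_
  apply shortExact_of_shortExact_inverseImage
  intro x
  obtain ⟨S, hx, hS⟩ := exists_isIso_inverseImage hY hZ hYZ x
  exact ⟨_, incl S, ⟨⟨x, hx⟩, rfl⟩, shortExact_map_squareComplex
    (HomologicalComplex.eval _ _ n ⋙ inverseImage (incl S)) _ (hS (K.X n))⟩

/-- The Mayer-Vietoris sequence is functorial. -/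
def mayerVietorisComplexMap (Y Z : Set X) {K L : CochainComplex (Shv X) ℤ} (f : K ⟶ L) :
    mayerVietorisComplex Y Z K ⟶ mayerVietorisComplex Y Z L where
  τ₁ := f
  τ₂ := biprod.map ((complexSupport Y).map f) ((complexSupport Z).map f)
  τ₃ := (complexSupport (Y ∩ Z)).map f
  comm₁₂ := by
    dsimp only [mayerVietorisComplex, squareComplex]
    apply biprod.hom_ext
    · simp
    · simp
  comm₂₃ := by
    have h₁ := (complexSupportMap (Set.inter_subset_left : Y ∩ Z ⊆ Y)).naturality f
    have h₂ := (complexSupportMap (Set.inter_subset_right : Y ∩ Z ⊆ Z)).naturality f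
    dsimp only [mayerVietorisComplex, squareComplex]
    apply biprod.hom_ext'
    · simpa using h₁
    · simpa using h₂

end MayerVietoris

/-! ### Adjunctions between derived categories -/

section DerivedAdj

universe w₁ w₂ v₁ v₂ u₁ u₂

variable {A : Type u₁} [Category.{v₁} A] [Abelian A] [HasDerivedCategory.{w₁} A]
  {B : Type u₂} [Category.{v₂} B] [Abelian B] [HasDerivedCategory.{w₂} B]

instance catCommSqMapDerivedCategory (F : A ⥤ B) [F.Additive] [PreservesFiniteLimits F]
    [PreservesFiniteColimits F] : CatCommSq (F.mapHomologicalComplex (ComplexShape.up ℤ))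
      DerivedCategory.Q DerivedCategory.Q F.mapDerivedCategory :=
  ⟨F.mapDerivedCategoryFactors.symm⟩

variable {P : A ⥤ B} {R : B ⥤ A} [P.Additive] [R.Additive]
  [PreservesFiniteLimits P] [PreservesFiniteColimits P]
  [PreservesFiniteLimits R] [PreservesFiniteColimits R]

/-- An adjunction of exact functors induces one between the derived categories. -/
def derivedAdj (adj : P ⊣ R) : P.mapDerivedCategory ⊣ R.mapDerivedCategory :=
  (mapComplexAdj adj).localization
    DerivedCategory.Q (HomologicalComplex.quasiIso A (ComplexShape.up ℤ))
    DerivedCategory.Q (HomologicalComplex.quasiIso B (ComplexShape.up ℤ)) _ _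

lemma derivedAdj_unit_app (adj : P ⊣ R) (K : CochainComplex A ℤ) :
    (derivedAdj adj).unit.app (DerivedCategory.Q.obj K) =
      DerivedCategory.Q.map ((mapComplexAdj adj).unit.app K) ≫
        R.mapDerivedCategoryFactors.inv.app _ ≫
          R.mapDerivedCategory.map (P.mapDerivedCategoryFactors.inv.app K) :=
  (mapComplexAdj adj).localization_unit_app _ _ _ _ _ _ K

lemma derivedAdj_counit_app (adj : P ⊣ R) (K : CochainComplex B ℤ) :
    (derivedAdj adj).counit.app (DerivedCategory.Q.obj K) =
      P.mapDerivedCategory.map (R.mapDerivedCategoryFactors.hom.app K) ≫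
        P.mapDerivedCategoryFactors.hom.app _ ≫
          DerivedCategory.Q.map ((mapComplexAdj adj).counit.app K) :=
  (mapComplexAdj adj).localization_counit_app _ _ _ _ _ _ K

/-- On `Q.obj K` the counit is the degreewise one up to isomorphisms, and `Q` is essentially
surjective. -/
instance isIso_derivedAdj_counit (adj : P ⊣ R) [IsIso adj.counit] :
    IsIso (derivedAdj adj).counit := by
  have (K : CochainComplex B ℤ) : IsIso ((mapComplexAdj adj).counit.app K) := by
    have (n : ℤ) : IsIso (((mapComplexAdj adj).counit.app K).f n) :=
      inferInstanceAs (IsIso (adj.counit.app (K.X n)))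
    exact HomologicalComplex.Hom.isIso_of_components _
  have h (K : CochainComplex B ℤ) :
      IsIso ((derivedAdj adj).counit.app (DerivedCategory.Q.obj K)) := by
    rw [derivedAdj_counit_app]
    infer_instance
  have h' (G : DerivedCategory B) : IsIso ((derivedAdj adj).counit.app G) := by
    rw [← NatTrans.isIso_app_iff_of_iso _ (DerivedCategory.Q.objObjPreimageIso G)]
    exact h _
  exact NatIso.isIso_of_isIso_app _

end DerivedAdj

/-! ### The Mayer-Vietoris triangle -/

section Triangle

variable [∀ X : TopCat.{u}, HasDerivedCategory.{w} (Shv X)] {X : TopCat.{u}}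

/-- The adjunction `i⁻¹ ⊣ i_*` between derived categories, for the inclusion `i` of a
closed subspace. -/
abbrev closedAdj (S : Set X) [Fact (IsClosed S)] :
    derivedInverseImage.{w} (incl S) ⊣ (directImage (incl S)).mapDerivedCategory :=
  derivedAdj (imageAdj (incl S))

/-- The functor `F ↦ i_* i⁻¹ F` on `D(X)`, for the inclusion `i` of a closed subspace. -/
abbrev derivedSupport (S : Set X) [Fact (IsClosed S)] : D.{w} X ⥤ D.{w} X :=
  derivedInverseImage (incl S) ⋙ (directImage (incl S)).mapDerivedCategory

/-- The functor `derivedSupport` is induced by `complexSupport`. -/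
def derivedSupportFactors (S : Set X) [Fact (IsClosed S)] :
    DerivedCategory.Q ⋙ derivedSupport.{w} S ≅ complexSupport S ⋙ DerivedCategory.Q :=
  Functor.isoWhiskerRight (inverseImage (incl S)).mapDerivedCategoryFactors _ ≪≫
    Functor.isoWhiskerLeft ((inverseImage (incl S)).mapHomologicalComplex (ComplexShape.up ℤ))
      (directImage (incl S)).mapDerivedCategoryFactors

instance (S : Set X) [Fact (IsClosed S)] : Localization.Lifting DerivedCategory.Q
    (HomologicalComplex.quasiIso (Shv X) (ComplexShape.up ℤ))
    (complexSupport S ⋙ DerivedCategory.Q) (derivedSupport.{w} S) :=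
  ⟨derivedSupportFactors S⟩

lemma closedAdj_unit_app (S : Set X) [Fact (IsClosed S)] (K : CochainComplex (Shv X) ℤ) :
    (closedAdj.{w} S).unit.app (DerivedCategory.Q.obj K) =
      DerivedCategory.Q.map ((mapComplexAdj (imageAdj (incl S))).unit.app K) ≫
        (derivedSupportFactors S).inv.app K :=
  derivedAdj_unit_app _ K

lemma closedAdj_unit_app_comp (S : Set X) [Fact (IsClosed S)] (K : CochainComplex (Shv X) ℤ) :
    (closedAdj.{w} S).unit.app (DerivedCategory.Q.obj K) ≫ (derivedSupportFactors S).hom.app K =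
      DerivedCategory.Q.map ((mapComplexAdj (imageAdj (incl S))).unit.app K) := by
  rw [closedAdj_unit_app]
  exact (Category.assoc _ _ _).trans ((congrArg _ (Iso.inv_hom_id_app _ _)).trans
    (Category.comp_id _))

/-- The morphism `supportMap` on derived categories. -/
def derivedSupportMap {S T : Set X} [Fact (IsClosed S)] [Fact (IsClosed T)] (h : S ⊆ T) :
    derivedSupport.{w} T ⟶ derivedSupport S :=
  Localization.liftNatTrans DerivedCategory.Q
    (HomologicalComplex.quasiIso (Shv X) (ComplexShape.up ℤ))
    (complexSupport T ⋙ DerivedCategory.Q) (complexSupport S ⋙ DerivedCategory.Q) _ _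
    (Functor.whiskerRight (complexSupportMap h) DerivedCategory.Q)

lemma derivedSupportMap_app {S T : Set X} [Fact (IsClosed S)] [Fact (IsClosed T)] (h : S ⊆ T)
    (K : CochainComplex (Shv X) ℤ) :
    (derivedSupportMap.{w} h).app (DerivedCategory.Q.obj K) =
      (derivedSupportFactors T).hom.app K ≫
        DerivedCategory.Q.map ((complexSupportMap h).app K) ≫
          (derivedSupportFactors S).inv.app K :=
  Localization.liftNatTrans_app _ _ _ _ _ _ _ _

lemma unit_derivedSupportMap {S T : Set X} [Fact (IsClosed S)] [Fact (IsClosed T)] (h : S ⊆ T)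
    (G : D.{w} X) :
    (closedAdj T).unit.app G ≫ (derivedSupportMap h).app G = (closedAdj S).unit.app G := by
  suffices (closedAdj.{w} T).unit ≫ derivedSupportMap h = (closedAdj S).unit from
    NatTrans.congr_app this G
  apply Localization.natTrans_ext DerivedCategory.Q
    (HomologicalComplex.quasiIso (Shv X) (ComplexShape.up ℤ))
  intro K
  rw [NatTrans.comp_app, closedAdj_unit_app, closedAdj_unit_app, derivedSupportMap_app,
    ← unit_complexSupportMap h]
  simp

variable {Y Z : Set X} [hY : Fact (IsClosed Y)] [hZ : Fact (IsClosed Z)]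

instance : Fact (IsClosed (Y ∩ Z)) := ⟨hY.out.inter hZ.out⟩

/-- The connecting morphism of the Mayer-Vietoris sequence of a complex of sheaves. -/
def complexδ (hYZ : Y ∪ Z = Set.univ) (K : CochainComplex (Shv X) ℤ) :
    (complexSupport (Y ∩ Z) ⋙ DerivedCategory.Q).obj K ⟶
      (shiftFunctor (D.{w} X) (1 : ℤ)).obj (DerivedCategory.Q.obj K) :=
  DerivedCategory.triangleOfSESδ (mayerVietorisComplex_shortExact hY.out hZ.out hYZ K)

/-- The connecting morphism of the Mayer-Vietoris triangle. -/
def mayerVietorisδ (hYZ : Y ∪ Z = Set.univ) :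
    derivedSupport.{w} (Y ∩ Z) ⟶ shiftFunctor (D.{w} X) (1 : ℤ) :=
  letI : Localization.Lifting DerivedCategory.Q
    (HomologicalComplex.quasiIso (Shv X) (ComplexShape.up ℤ))
    (DerivedCategory.Q ⋙ shiftFunctor (D.{w} X) (1 : ℤ)) (shiftFunctor (D.{w} X) (1 : ℤ)) :=
    ⟨Iso.refl _⟩
  Localization.liftNatTrans DerivedCategory.Q
    (HomologicalComplex.quasiIso (Shv X) (ComplexShape.up ℤ))
    (complexSupport (Y ∩ Z) ⋙ DerivedCategory.Q)
    (DerivedCategory.Q ⋙ shiftFunctor (D.{w} X) (1 : ℤ)) _ _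
    { app K := complexδ hYZ K
      naturality K L f := (DerivedCategory.triangleOfSESδ_naturality
        (mayerVietorisComplex_shortExact hY.out hZ.out hYZ K)
        (mayerVietorisComplex_shortExact hY.out hZ.out hYZ L)
        (mayerVietorisComplexMap Y Z f)).symm }

lemma mayerVietorisδ_app (hYZ : Y ∪ Z = Set.univ) (K : CochainComplex (Shv X) ℤ) :
    (mayerVietorisδ.{w} hYZ).app (DerivedCategory.Q.obj K) =
      (derivedSupportFactors (Y ∩ Z)).hom.app K ≫ complexδ hYZ K := by
  let : Localization.Lifting DerivedCategory.Q
    (HomologicalComplex.quasiIso (Shv X) (ComplexShape.up ℤ))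
    (DerivedCategory.Q ⋙ shiftFunctor (D.{w} X) (1 : ℤ)) (shiftFunctor (D.{w} X) (1 : ℤ)) :=
    ⟨Iso.refl _⟩
  refine (Localization.liftNatTrans_app DerivedCategory.Q
    (HomologicalComplex.quasiIso (Shv X) (ComplexShape.up ℤ)) _ _ _ _ _ _).trans ?_
  exact congrArg _ (Category.comp_id _)

end Triangle

/-- The adjunct of `f ≫ m` factors through `P.map f`. Allowing `V` to be merely isomorphic to `R.obj
V'` covers shifts of direct images. -/
lemma comp_eq_zero_of_leftAdjoint_map_eq_zero {C D : Type*} [Category* C] [Category* D]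
    [HasZeroMorphisms C] [HasZeroMorphisms D] {P : C ⥤ D} {R : D ⥤ C} (adj : P ⊣ R)
    {F G V : C} {V' : D} (e : V ≅ R.obj V') {f : F ⟶ G} (hf : P.map f = 0) (m : G ⟶ V) :
    f ≫ m = 0 := by
  have := adj.isLeftAdjoint
  have : P.PreservesZeroMorphisms := inferInstance
  rw [← cancel_mono e.hom, zero_comp]
  apply (adj.homEquiv _ _).symm.injective
  rw [Category.assoc, adj.homEquiv_naturality_left_symm, hf, zero_comp, adj.homEquiv_counit,
    P.map_zero, zero_comp]

/-! ### Hom into the distinguished triangle of a bicartesian square of complexes -/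

section SquareTriangle

universe w₁ v₁ u₁

variable {A : Type u₁} [Category.{v₁} A] [Abelian A] [HasDerivedCategory.{w₁} A]
  {X Y Z W : CochainComplex A ℤ} {a : X ⟶ Y} {b : X ⟶ Z} {c : Y ⟶ W} {d : Z ⟶ W}
  {h : a ≫ c = b ≫ d} (hS : (squareComplex a b c d h).ShortExact)

open DerivedCategory Pretriangulated

/-- The connecting morphism of a bicartesian square of complexes. -/
def squareδ : Q.obj W ⟶ (Q.obj X)⟦(1 : ℤ)⟧ := triangleOfSESδ hS

lemma squareTriangle_distinguished :
    Pretriangulated.Triangle.mk (Q.map (biprod.lift a b)) (Q.map (biprod.desc c (-d)))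
      (squareδ hS) ∈ distTriang (DerivedCategory A) :=
  triangleOfSES_distinguished hS

lemma map_comp_squareδ : Q.map c ≫ squareδ hS = 0 ∧ Q.map d ≫ squareδ hS = 0 := by
  have h : Q.map (biprod.desc c (-d)) ≫ squareδ hS = 0 :=
    Pretriangulated.comp_distTriang_mor_zero₂₃ _ (squareTriangle_distinguished hS)
  refine ⟨?_, ?_⟩
  · have h' := Q.map biprod.inl ≫= h
    rwa [← Functor.map_comp_assoc, biprod.inl_desc, comp_zero] at h'
  · have h' := Q.map biprod.inr ≫= h
    rwa [← Functor.map_comp_assoc, biprod.inr_desc, comp_zero, Functor.map_neg,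
      Preadditive.neg_comp, neg_eq_zero] at h'

lemma squareδ_comp_map : squareδ hS ≫ (Q.map a)⟦(1 : ℤ)⟧' = 0 ∧
    squareδ hS ≫ (Q.map b)⟦(1 : ℤ)⟧' = 0 := by
  have h : squareδ hS ≫ (Q.map (biprod.lift a b))⟦(1 : ℤ)⟧' = 0 :=
    Pretriangulated.comp_distTriang_mor_zero₃₁ _ (squareTriangle_distinguished hS)
  refine ⟨?_, ?_⟩
  · have h' := h =≫ (Q.map biprod.fst)⟦(1 : ℤ)⟧'
    rwa [Category.assoc, ← Functor.map_comp, ← Functor.map_comp, biprod.lift_fst, zero_comp] at h'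
  · have h' := h =≫ (Q.map biprod.snd)⟦(1 : ℤ)⟧'
    rwa [Category.assoc, ← Functor.map_comp, ← Functor.map_comp, biprod.lift_snd, zero_comp] at h'

-- Exactness of `Hom(F, -)` at the biproduct, split into components; the sign of `d` in the complex
-- turns a zero composite into an equality.
include hS in
lemma square_exact₁ {F : DerivedCategory A} (s : F ⟶ Q.obj Y) (t : F ⟶ Q.obj Z)
    (hst : s ≫ Q.map c = t ≫ Q.map d) : ∃ g : F ⟶ Q.obj X, g ≫ Q.map a = s ∧ g ≫ Q.map b = t := by
  obtain ⟨g, hg⟩ : ∃ g : F ⟶ Q.obj X,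
      s ≫ Q.map biprod.inl + t ≫ Q.map biprod.inr = g ≫ Q.map (biprod.lift a b) :=
    Pretriangulated.Triangle.coyoneda_exact₂ _ (squareTriangle_distinguished hS)
    (s ≫ Q.map biprod.inl + t ≫ Q.map biprod.inr) (by
      change (s ≫ Q.map biprod.inl + t ≫ Q.map biprod.inr) ≫ Q.map (biprod.desc c (-d)) = 0
      rw [Preadditive.add_comp, Category.assoc, Category.assoc, ← Q.map_comp, ← Q.map_comp,
        biprod.inl_desc, biprod.inr_desc, Q.map_neg, hst]
      simp)
  refine ⟨g, ?_, ?_⟩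
  · have h' := hg =≫ Q.map biprod.fst
    rw [Category.assoc, ← Q.map_comp, biprod.lift_fst] at h'
    rw [← h', Preadditive.add_comp, Category.assoc, Category.assoc, ← Q.map_comp, ← Q.map_comp]
    simp
  · have h' := hg =≫ Q.map biprod.snd
    rw [Category.assoc, ← Q.map_comp, biprod.lift_snd] at h'
    rw [← h', Preadditive.add_comp, Category.assoc, Category.assoc, ← Q.map_comp, ← Q.map_comp]
    simp

lemma square_exact₂ {F : DerivedCategory A} (r : F ⟶ Q.obj W) (hr : r ≫ squareδ hS = 0) :
    ∃ (s : F ⟶ Q.obj Y) (t : F ⟶ Q.obj Z), r = s ≫ Q.map c - t ≫ Q.map d := by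
  obtain ⟨g, hg⟩ : ∃ g : F ⟶ Q.obj (Y ⊞ Z), r = g ≫ Q.map (biprod.desc c (-d)) :=
    Pretriangulated.Triangle.coyoneda_exact₃ _ (squareTriangle_distinguished hS) r hr
  refine ⟨g ≫ Q.map biprod.fst, g ≫ Q.map biprod.snd, hg.trans ?_⟩
  rw [biprod.desc_eq, Q.map_add]
  simp [sub_eq_add_neg]

lemma square_exact₃ {F : DerivedCategory A} (g : F ⟶ (Q.obj X)⟦(1 : ℤ)⟧)
    (ha : g ≫ (Q.map a)⟦(1 : ℤ)⟧' = 0) (hb : g ≫ (Q.map b)⟦(1 : ℤ)⟧' = 0) :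
    ∃ r : F ⟶ Q.obj W, r ≫ squareδ hS = g := by
  obtain ⟨r, hr⟩ := Pretriangulated.Triangle.coyoneda_exact₁ _ (squareTriangle_distinguished hS)
    g (by
      change g ≫ (Q.map (biprod.lift a b))⟦(1 : ℤ)⟧' = 0
      rw [biprod.lift_eq, Q.map_add, Functor.map_add, Q.map_comp, Q.map_comp, Functor.map_comp,
        Functor.map_comp, Preadditive.comp_add, reassoc_of% ha, reassoc_of% hb]
      simp)
  exact ⟨r, hr.symm⟩

end SquareTriangle

/-! ### Exactness of Hom into the Mayer-Vietoris triangle of an arbitrary object of `D(X)` -/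

section Triangle

variable [∀ X : TopCat.{u}, HasDerivedCategory.{w} (Shv X)] {X : TopCat.{u}}
variable {Y Z : Set X} [hY : Fact (IsClosed Y)] [hZ : Fact (IsClosed Z)]

lemma comp_shift_unit_eq_zero (S : Set X) [Fact (IsClosed S)] {F G : D.{w} X}
    (f : F ⟶ G⟦(1 : ℤ)⟧) (hf : (derivedInverseImage (incl S)).map f = 0) :
    f ≫ ((closedAdj S).unit.app G)⟦(1 : ℤ)⟧' = 0 :=
  comp_eq_zero_of_leftAdjoint_map_eq_zero (closedAdj S)
    (((directImage (incl S)).mapDerivedCategory.commShiftIso (1 : ℤ)).symm.app _) hf _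

lemma derivedSupportMap_comp_δ (hYZ : Y ∪ Z = Set.univ) (G : D.{w} X) :
    (derivedSupportMap (Set.inter_subset_left : Y ∩ Z ⊆ Y)).app G ≫
      (mayerVietorisδ hYZ).app G = 0 ∧
    (derivedSupportMap (Set.inter_subset_right : Y ∩ Z ⊆ Z)).app G ≫
      (mayerVietorisδ hYZ).app G = 0 := by
  suffices derivedSupportMap.{w} (Set.inter_subset_left : Y ∩ Z ⊆ Y) ≫ mayerVietorisδ hYZ = 0 ∧
      derivedSupportMap.{w} (Set.inter_subset_right : Y ∩ Z ⊆ Z) ≫ mayerVietorisδ hYZ = 0 from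
    ⟨NatTrans.congr_app this.1 G, NatTrans.congr_app this.2 G⟩
  have h (K : CochainComplex (Shv X) ℤ) :=
    map_comp_squareδ (mayerVietorisComplex_shortExact hY.out hZ.out hYZ K)
  refine ⟨?_, ?_⟩
  all_goals
    apply Localization.natTrans_ext DerivedCategory.Q
      (HomologicalComplex.quasiIso (Shv X) (ComplexShape.up ℤ))
    intro K
    rw [NatTrans.comp_app, derivedSupportMap_app, mayerVietorisδ_app]
    simp only [Category.assoc, Iso.inv_hom_id_app_assoc]
  · exact (congrArg ((derivedSupportFactors Y).hom.app K ≫ ·) (h K).1).trans comp_zero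
  · exact (congrArg ((derivedSupportFactors Z).hom.app K ≫ ·) (h K).2).trans comp_zero

/-- Since the counit of `closedAdj` is invertible, `i⁻¹` inverts the unit, and it commutes with the
shift. This is the converse of `comp_shift_unit_eq_zero`. -/
lemma derivedInverseImage_map_eq_zero (S : Set X) [Fact (IsClosed S)] {F G : D.{w} X}
    (f : F ⟶ G⟦(1 : ℤ)⟧) (hf : f ≫ ((closedAdj S).unit.app G)⟦(1 : ℤ)⟧' = 0) :
    (derivedInverseImage (incl S)).map f = 0 := by
  have h₁ : IsIso ((derivedInverseImage (incl S)).map ((closedAdj S).unit.app G)) :=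
    isIso_map_unit_of_isIso_counit (closedAdj S) (Functor.rightUnitor _) G
  have h₂ : IsIso ((derivedInverseImage (incl S)).map
      (((closedAdj S).unit.app G)⟦(1 : ℤ)⟧')) :=
    (NatIso.isIso_map_iff ((derivedInverseImage (incl S)).commShiftIso (1 : ℤ))
      ((closedAdj S).unit.app G)).2
        (inferInstanceAs (IsIso (((derivedInverseImage (incl S)).map _)⟦(1 : ℤ)⟧')))
  rw [← cancel_mono ((derivedInverseImage (incl S)).map (((closedAdj S).unit.app G)⟦(1 : ℤ)⟧')),
    ← Functor.map_comp, hf, Functor.map_zero, zero_comp]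

/-- Consecutive maps of the triangle compose to zero, so `δ` followed by the shifted unit of `Y` or
`Z` vanishes; `derivedInverseImage_map_eq_zero` then applies. -/
lemma derivedInverseImage_map_mayerVietorisδ (hYZ : Y ∪ Z = Set.univ) (G : D.{w} X) :
    (derivedInverseImage (incl Y)).map ((mayerVietorisδ hYZ).app G) = 0 ∧
    (derivedInverseImage (incl Z)).map ((mayerVietorisδ hYZ).app G) = 0 := by
  obtain ⟨K, ⟨e⟩⟩ : ∃ K, Nonempty (DerivedCategory.Q.obj K ≅ G) :=
    ⟨_, ⟨DerivedCategory.Q.objObjPreimageIso G⟩⟩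
  have h := squareδ_comp_map (mayerVietorisComplex_shortExact hY.out hZ.out hYZ K)
  have key (S : Set X) [Fact (IsClosed S)] (hS : complexδ.{w} hYZ K ≫ (DerivedCategory.Q.map
        ((mapComplexAdj (imageAdj (incl S))).unit.app K))⟦(1 : ℤ)⟧' = 0) :
      (derivedInverseImage (incl S)).map ((mayerVietorisδ.{w} hYZ).app G) = 0 := by
    have h₁ : (derivedInverseImage (incl S)).map
        ((mayerVietorisδ.{w} hYZ).app (DerivedCategory.Q.obj K)) = 0 := by
      apply derivedInverseImage_map_eq_zero
      rw [closedAdj_unit_app, mayerVietorisδ_app, Functor.map_comp, Category.assoc]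
      exact (congrArg _ ((Category.assoc _ _ _).symm.trans
        ((hS =≫ _).trans zero_comp))).trans comp_zero
    have h₂ := (mayerVietorisδ.{w} hYZ).naturality e.inv
    rw [← cancel_mono ((derivedInverseImage (incl S)).map (e.inv⟦(1 : ℤ)⟧')), ← Functor.map_comp,
      zero_comp]
    refine (congrArg _ h₂.symm).trans ?_
    rw [Functor.map_comp, h₁, comp_zero]
  exact ⟨key Y h.1, key Z h.2⟩

/-- The triangle is only constructed on objects `Q.obj K`; naturality carries `square_exact₁` along
an isomorphism from `G` to such an object. -/
lemma exists_lift_of_comp_derivedSupportMap_eq (hYZ : Y ∪ Z = Set.univ) {F G : D.{w} X}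
    (a : F ⟶ (derivedSupport Y).obj G) (b : F ⟶ (derivedSupport Z).obj G)
    (h : a ≫ (derivedSupportMap (Set.inter_subset_left : Y ∩ Z ⊆ Y)).app G =
      b ≫ (derivedSupportMap (Set.inter_subset_right : Y ∩ Z ⊆ Z)).app G) :
    ∃ g : F ⟶ G, g ≫ (closedAdj Y).unit.app G = a ∧ g ≫ (closedAdj Z).unit.app G = b := by
  obtain ⟨K, ⟨e⟩⟩ : ∃ K, Nonempty (G ≅ DerivedCategory.Q.obj K) :=
    ⟨_, ⟨(DerivedCategory.Q.objObjPreimageIso G).symm⟩⟩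
  obtain ⟨g, hga, hgb⟩ := square_exact₁ (mayerVietorisComplex_shortExact hY.out hZ.out hYZ K)
    (a ≫ (derivedSupport Y).map e.hom ≫ (derivedSupportFactors Y).hom.app K)
    (b ≫ (derivedSupport Z).map e.hom ≫ (derivedSupportFactors Z).hom.app K) (by
      rw [← cancel_mono ((derivedSupportFactors (Y ∩ Z)).inv.app K)]
      have h' := h =≫ (derivedSupport (Y ∩ Z)).map e.hom
      rw [Category.assoc, Category.assoc, ← NatTrans.naturality, ← NatTrans.naturality,
        derivedSupportMap_app, derivedSupportMap_app] at h'
      simpa only [Category.assoc] using h')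
  refine ⟨g ≫ e.inv, ?_, ?_⟩
  · rw [Category.assoc]
    have h₁ := (closedAdj Y).unit.naturality e.inv
    dsimp only [Functor.id_map] at h₁
    rw [h₁, closedAdj_unit_app, Category.assoc, reassoc_of% hga]
    simp [← Functor.map_comp]
  · rw [Category.assoc]
    have h₁ := (closedAdj Z).unit.naturality e.inv
    dsimp only [Functor.id_map] at h₁
    rw [h₁, closedAdj_unit_app, Category.assoc, reassoc_of% hgb]
    simp [← Functor.map_comp]

lemma exists_of_comp_mayerVietorisδ_eq_zero (hYZ : Y ∪ Z = Set.univ) {F G : D.{w} X}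
    (c : F ⟶ (derivedSupport (Y ∩ Z)).obj G) (hc : c ≫ (mayerVietorisδ hYZ).app G = 0) :
    ∃ (a : F ⟶ (derivedSupport Y).obj G) (b : F ⟶ (derivedSupport Z).obj G),
      c = a ≫ (derivedSupportMap (Set.inter_subset_left : Y ∩ Z ⊆ Y)).app G -
        b ≫ (derivedSupportMap (Set.inter_subset_right : Y ∩ Z ⊆ Z)).app G := by
  obtain ⟨K, ⟨e⟩⟩ : ∃ K, Nonempty (G ≅ DerivedCategory.Q.obj K) :=
    ⟨_, ⟨(DerivedCategory.Q.objObjPreimageIso G).symm⟩⟩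
  obtain ⟨s, t, h⟩ := square_exact₂ (mayerVietorisComplex_shortExact hY.out hZ.out hYZ K)
    (c ≫ (derivedSupport (Y ∩ Z)).map e.hom ≫ (derivedSupportFactors (Y ∩ Z)).hom.app K) (by
      have h' := hc =≫ e.hom⟦(1 : ℤ)⟧'
      rw [Category.assoc, ← NatTrans.naturality, mayerVietorisδ_app, zero_comp] at h'
      exact (Category.assoc _ _ _).trans ((congrArg (c ≫ ·) (Category.assoc _ _ _)).trans h'))
  refine ⟨s ≫ (derivedSupportFactors Y).inv.app K ≫ (derivedSupport Y).map e.inv,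
    t ≫ (derivedSupportFactors Z).inv.app K ≫ (derivedSupport Z).map e.inv, ?_⟩
  have h' := h =≫ ((derivedSupportFactors (Y ∩ Z)).inv.app K ≫
    (derivedSupport (Y ∩ Z)).map e.inv)
  rw [Preadditive.sub_comp] at h'
  simp only [Category.assoc, NatTrans.naturality, derivedSupportMap_app,
    Iso.hom_inv_id_app_assoc, Iso.inv_hom_id_app_assoc] at h' ⊢
  rw [← h', ← Functor.map_comp, e.hom_inv_id]
  simp

/-- Vanishing of `g` on `Y` and `Z` means that its composites with the shifted units vanish, which
is the hypothesis of `square_exact₃`. -/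
lemma exists_comp_mayerVietorisδ_eq (hYZ : Y ∪ Z = Set.univ) {F G : D.{w} X}
    (g : F ⟶ G⟦(1 : ℤ)⟧) (h₁ : (derivedInverseImage (incl Y)).map g = 0)
    (h₂ : (derivedInverseImage (incl Z)).map g = 0) :
    ∃ c : F ⟶ (derivedSupport (Y ∩ Z)).obj G, c ≫ (mayerVietorisδ hYZ).app G = g := by
  obtain ⟨K, ⟨e⟩⟩ : ∃ K, Nonempty (G ≅ DerivedCategory.Q.obj K) :=
    ⟨_, ⟨(DerivedCategory.Q.objObjPreimageIso G).symm⟩⟩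
  have key (S : Set X) [Fact (IsClosed S)] (hS : (derivedInverseImage (incl S)).map g = 0) :
      (g ≫ e.hom⟦(1 : ℤ)⟧') ≫ (DerivedCategory.Q.map
        ((mapComplexAdj (imageAdj (incl S))).unit.app K))⟦(1 : ℤ)⟧' = 0 := by
    have h := comp_shift_unit_eq_zero S (g ≫ e.hom⟦(1 : ℤ)⟧')
      (by rw [Functor.map_comp, hS, zero_comp])
    have h' := h =≫ ((derivedSupportFactors S).hom.app K)⟦(1 : ℤ)⟧'
    rw [Category.assoc, ← Functor.map_comp] at h'
    rw [← closedAdj_unit_app_comp]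
    exact h'.trans zero_comp
  obtain ⟨r, hr⟩ := square_exact₃ (mayerVietorisComplex_shortExact hY.out hZ.out hYZ K)
    (g ≫ e.hom⟦(1 : ℤ)⟧') (key Y h₁) (key Z h₂)
  refine ⟨r ≫ (derivedSupportFactors (Y ∩ Z)).inv.app K ≫ (derivedSupport (Y ∩ Z)).map e.inv, ?_⟩
  simp only [Category.assoc, NatTrans.naturality, mayerVietorisδ_app, Iso.inv_hom_id_app_assoc]
  have hr' : (r ≫ complexδ hYZ K) ≫ e.inv⟦(1 : ℤ)⟧' = _ := hr =≫ e.inv⟦(1 : ℤ)⟧'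
  rw [Category.assoc, Category.assoc, ← Functor.map_comp, e.hom_inv_id,
    CategoryTheory.Functor.map_id, Category.comp_id] at hr'
  exact hr'

end Triangle

/-! ### Morphisms to an injective object in the derived category -/

section Injective

universe w₁ v₁ u₁

variable {A : Type u₁} [Category.{v₁} A] [Abelian A] [HasDerivedCategory.{w₁} A]

open DerivedCategory HomologicalComplex CochainComplex.HomComplex

/-- An object of an abelian category, as a complex in degree `n`, in the derived category. -/
abbrev derivedSingle (I : A) (n : ℤ) : DerivedCategory A :=
  Q.obj ((HomologicalComplex.single A (ComplexShape.up ℤ) n).obj I)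

/-- The cohomology of `derivedSingle` in the only relevant degree. -/
def homologyDerivedSingleIso (I : A) (n : ℤ) :
    (DerivedCategory.homologyFunctor A n).obj (derivedSingle I n) ≅ I :=
  (homologyFunctorFactors A n).app _ ≪≫ singleObjHomologySelfIso (ComplexShape.up ℤ) n I

/-- Such an `f` kills the cycles of degree `n`, so its component there extends along `d` to degree
`n + 1` by injectivity of `I`; the extension is a null-homotopy. -/
lemma Q_map_eq_zero_of_homologyMap_eq_zero {I : A} [Injective I] {n : ℤ} {K : CochainComplex A ℤ}
    (f : K ⟶ (HomologicalComplex.single A (ComplexShape.up ℤ) n).obj I) (hf : homologyMap f n = 0) :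
    Q.map f = 0 := by
  have h₁ : cyclesMap f n = 0 := by
    rw [← cancel_mono (singleObjCyclesSelfIso (ComplexShape.up ℤ) n I).hom,
      ← homologyπ_singleObjHomologySelfIso_hom]
    have := homologyπ_naturality f n =≫ (singleObjHomologySelfIso (ComplexShape.up ℤ) n I).hom
    rw [hf, comp_zero, zero_comp] at this
    rw [zero_comp]
    exact (Category.assoc _ _ _).symm.trans this.symm
  have h₂ : K.iCycles n ≫ f.f n = 0 := by
    rw [← cyclesMap_i, h₁, zero_comp]
  let S : ShortComplex A := ShortComplex.mk (K.iCycles n) (K.d n (n + 1)) (K.iCycles_d _ _)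
  have hS : S.Exact := S.exact_of_f_is_kernel (K.cyclesIsKernel n (n + 1) (by simp))
  let φ : K.X n ⟶ I := f.f n ≫ (singleObjXSelf (ComplexShape.up ℤ) n I).hom
  have hφ : S.f ≫ φ = 0 := (Category.assoc _ _ _).symm.trans ((h₂ =≫ _).trans zero_comp)
  obtain ⟨ψ, hψ⟩ : ∃ ψ : K.X (n + 1) ⟶ I, K.d n (n + 1) ≫ ψ = φ :=
    ⟨_, hS.comp_descToInjective φ hφ⟩
  let f' : K ⟶ (CochainComplex.singleFunctor A n).obj I := f
  have e : Homotopy f' 0 := (Cochain.equivHomotopy f' 0).symm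
    ⟨Cochain.toSingleMk ψ (by simp), by
      rw [Cochain.ofHom_zero, add_zero, Cochain.δ_toSingleMk _ _ _ n (by simp), hψ,
        Int.negOnePow_zero, one_smul]
      apply (Cochain.toSingleEquiv (add_zero n)).injective
      rw [Cochain.toSingleEquiv_toSingleMk]
      simp [Cochain.toSingleEquiv, φ, f']
      exact congrArg (· ≫ _) (Cochain.ofHom_v f n)⟩
  exact (DerivedCategory.Q_map_eq_of_homotopy A e).trans (Functor.map_zero _ _ _)

/-- Calculus of fractions writes `x`, up to isomorphism, as a map of complexes preceded by the
inverse of a quasi-isomorphism. -/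
lemma eq_zero_of_homologyFunctor_map_eq_zero {I : A} [Injective I] {n : ℤ} {K : DerivedCategory A}
    (x : K ⟶ derivedSingle I n) (hx : (DerivedCategory.homologyFunctor A n).map x = 0) : x = 0 := by
  obtain ⟨L, ⟨e⟩⟩ : ∃ L, Nonempty (Q.obj L ≅ K) := ⟨_, ⟨Q.objObjPreimageIso K⟩⟩
  obtain ⟨L', s, _, g, hg⟩ := right_fac (e.hom ≫ x)
  have hg' : Q.map g = Q.map s ≫ e.hom ≫ x := by rw [hg, IsIso.hom_inv_id_assoc]
  have : Q.map g = 0 := by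
    apply Q_map_eq_zero_of_homologyMap_eq_zero
    refine (cancel_epi ((homologyFunctorFactors A n).hom.app L')).1 ?_
    refine (homologyFunctorFactors_hom_naturality g n).symm.trans ?_
    rw [hg', Functor.map_comp, Functor.map_comp, hx, comp_zero, comp_zero, zero_comp]
    exact comp_zero.symm
  rw [← cancel_epi e.hom, hg, this, comp_zero, comp_zero]

lemma exists_homologyFunctor_map_eq {I : A} [Injective I] {n : ℤ} {K : DerivedCategory A}
    (χ : (DerivedCategory.homologyFunctor A n).obj K ⟶ I) :
    ∃ x : K ⟶ derivedSingle I n, (DerivedCategory.homologyFunctor A n).map x ≫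
      (homologyDerivedSingleIso I n).hom = χ := by
  obtain ⟨L, ⟨e⟩⟩ : ∃ L, Nonempty (K ≅ Q.obj L) := ⟨_, ⟨(Q.objObjPreimageIso K).symm⟩⟩
  let χ' : L.homology n ⟶ I := (homologyFunctorFactors A n).inv.app L ≫
    (DerivedCategory.homologyFunctor A n).map e.inv ≫ χ
  -- Homology embeds in the opcycles, so injectivity extends `χ'`; a map from the opcycles is the
  -- same as a map of complexes to `I` in degree `n`.
  let ψ : L.opcycles n ⟶ I := Injective.factorThru χ' (L.homologyι n)
  let f : L ⟶ (HomologicalComplex.single A (ComplexShape.up ℤ) n).obj I :=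
    mkHomToSingle (L.pOpcycles n ≫ ψ) (fun i _ ↦ by rw [d_pOpcycles_assoc, zero_comp])
  have h₁ : opcyclesMap f n ≫ (singleObjOpcyclesSelfIso (ComplexShape.up ℤ) n I).inv = ψ := by
    rw [← cancel_epi (L.pOpcycles n), p_opcyclesMap_assoc]
    erw [pOpcycles_singleObjOpcyclesSelfIso_inv, mkHomToSingle_f]
    simp
  have h₂ : homologyMap f n ≫ (singleObjHomologySelfIso (ComplexShape.up ℤ) n I).hom = χ' := by
    rw [← homologyι_singleObjOpcyclesSelfIso_inv]
    erw [homologyι_naturality_assoc]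
    rw [h₁]
    exact Injective.comp_factorThru _ _
  refine ⟨e.hom ≫ Q.map f, ?_⟩
  have h₃ : (DerivedCategory.homologyFunctor A n).map (Q.map f) ≫
      (homologyDerivedSingleIso I n).hom = (homologyFunctorFactors A n).hom.app L ≫ χ' :=
    (Category.assoc _ _ _).symm.trans ((homologyFunctorFactors_hom_naturality f n =≫
      (singleObjHomologySelfIso (ComplexShape.up ℤ) n I).hom).trans
        ((Category.assoc _ _ _).trans (congrArg _ h₂)))
  rw [Functor.map_comp, Category.assoc, h₃]
  refine (congrArg _ ((homologyFunctorFactors A n).hom_inv_id_app_assoc L _)).trans ?_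
  rw [← Functor.map_comp_assoc, e.hom_inv_id, CategoryTheory.Functor.map_id, Category.id_comp]

end Injective

/-! ### Compatibility of inverse images of constant sheaves -/

/-- Both sides have the same adjunct `t` under the composite of the three adjunctions. The
hypotheses have the form of the unit formulas characterising isomorphisms between left adjoints. -/
lemma comp_eq_of_unit_comp {A B₁ B₂ B₃ : Type*} [Category* A] [Category* B₁] [Category* B₂]
    [Category* B₃] {P₁ : A ⥤ B₁} {R₁ : B₁ ⥤ A} {P₂ : B₁ ⥤ B₂} {R₂ : B₂ ⥤ B₁} {P₃ : B₂ ⥤ B₃}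
    {R₃ : B₃ ⥤ B₂} (adj₁ : P₁ ⊣ R₁) (adj₂ : P₂ ⊣ R₂) (adj₃ : P₃ ⊣ R₃) {M : A} {E : B₂} {N T : B₃}
    {c : P₃.obj (P₂.obj (P₁.obj M)) ⟶ N} {κ : N ⟶ T} {κ₂ : P₂.obj (P₁.obj M) ⟶ E}
    {κ₃ : P₃.obj E ⟶ T} {u : P₁.obj M ⟶ R₂.obj (R₃.obj N)} {v : M ⟶ R₁.obj (R₂.obj E)}
    {t : M ⟶ R₁.obj (R₂.obj (R₃.obj T))}
    (h₁ : (adj₂.unit.app (P₁.obj M) ≫ R₂.map (adj₃.unit.app (P₂.obj (P₁.obj M)))) ≫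
      R₂.map (R₃.map c) = u)
    (h₂ : (adj₁.unit.app M ≫ R₁.map u) ≫ R₁.map (R₂.map (R₃.map κ)) = t)
    (h₃ : (adj₁.unit.app M ≫ R₁.map (adj₂.unit.app (P₁.obj M))) ≫ R₁.map (R₂.map κ₂) = v)
    (h₄ : (v ≫ R₁.map (R₂.map (adj₃.unit.app E))) ≫ R₁.map (R₂.map (R₃.map κ₃)) = t) :
    c ≫ κ = P₃.map κ₂ ≫ κ₃ := by
  apply (((adj₁.comp adj₂).comp adj₃).homEquiv M _).injective
  subst h₁ h₃
  have := h₂.trans h₄.symm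
  have h₅ := adj₃.unit.naturality κ₂
  simp only [Functor.id_map, Functor.comp_map] at h₅
  simp only [Category.assoc, ← Functor.map_comp] at this
  rw [reassoc_of% h₅] at this
  simp only [Adjunction.homEquiv_unit, Adjunction.comp_unit_app, Functor.comp_map,
    Functor.map_comp, Category.assoc] at this ⊢
  exact this

lemma inverseImageComp_hom_app_constant {X Y Z : TopCat.{u}} (f : X ⟶ Y) (g : Y ⟶ Z) (h : X ⟶ Z)
    (w : f ≫ g = h) (M : AddCommGrpCat.{u}) :
    (inverseImageComp f g h w).hom.app ((constant Z).obj M) ≫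
        (constantInverseImage h).hom.app M =
      (inverseImage f).map ((constantInverseImage g).hom.app M) ≫
        (constantInverseImage f).hom.app M := by
  subst w
  let αf := TopCat.Sheaf.pullbackPushforwardAdjunction AddCommGrpCat.{u} f
  let αg := TopCat.Sheaf.pullbackPushforwardAdjunction AddCommGrpCat.{u} g
  let αh := TopCat.Sheaf.pullbackPushforwardAdjunction AddCommGrpCat.{u} (f ≫ g)
  have h₁ := Adjunction.unit_leftAdjointUniq_hom_app
    ((αg.comp αf).ofNatIsoRight (eqToIso rfl)) αh ((constant Z).obj M)
  have h₂ := Adjunction.unit_leftAdjointUniq_hom_app ((constantAdj Z).comp αh)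
    ((constantAdj X).ofNatIsoRight (Iso.refl _)) M
  have h₃ := Adjunction.unit_leftAdjointUniq_hom_app ((constantAdj Z).comp αg)
    ((constantAdj Y).ofNatIsoRight (Iso.refl _)) M
  have h₄ := Adjunction.unit_leftAdjointUniq_hom_app ((constantAdj Y).comp αf)
    ((constantAdj X).ofNatIsoRight (Iso.refl _)) M
  rw [Adjunction.comp_unit_app] at h₂ h₃ h₄
  exact comp_eq_of_unit_comp (constantAdj Z) αg αf h₁ h₂ h₃ h₄

lemma derivedComp_hom_app_Q {A B C : Type (u + 1)} [Category.{u} A] [Abelian A] [Category.{u} B]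
    [Abelian B] [Category.{u} C] [Abelian C] [HasDerivedCategory.{w} A] [HasDerivedCategory.{w} B]
    [HasDerivedCategory.{w} C] {F : A ⥤ B} {G : B ⥤ C} {H : A ⥤ C}
    [F.Additive] [PreservesFiniteLimits F] [PreservesFiniteColimits F]
    [G.Additive] [PreservesFiniteLimits G] [PreservesFiniteColimits G]
    [H.Additive] [PreservesFiniteLimits H] [PreservesFiniteColimits H] (e : F ⋙ G ≅ H)
    (K : CochainComplex A ℤ) :
    (derivedComp e).hom.app (DerivedCategory.Q.obj K) =
      G.mapDerivedCategory.map (F.mapDerivedCategoryFactors.hom.app K) ≫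
        G.mapDerivedCategoryFactors.hom.app
          ((F.mapHomologicalComplex (ComplexShape.up ℤ)).obj K) ≫
        DerivedCategory.Q.map
          ((NatTrans.mapHomologicalComplex e.hom (ComplexShape.up ℤ)).app K) ≫
        H.mapDerivedCategoryFactors.inv.app K := by
  refine (Localization.liftNatTrans_app ..).trans ?_
  simp only [Localization.Lifting.iso]
  dsimp
  simp only [Category.id_comp, Category.comp_id]
  rfl

lemma comp_eq_of_comp_eq {C : Type*} [Category* C]
    {X₁ X₂ X₃ X₄ X₅ X₆ X₇ X₈ X₉ X₁₀ X₁₁ X₁₂ : C} {f : X₁ ⟶ X₂} {p : X₂ ⟶ X₃} {q : X₃ ⟶ X₄} {r : X₄ ⟶ X₅}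
    {s : X₅ ⟶ X₆} {c : X₁ ⟶ X₇} {g : X₇ ⟶ X₆} {t : X₆ ⟶ X₅} {r' : X₅ ⟶ X₈} {s' : X₈ ⟶ X₉}
    {l : X₃ ⟶ X₁₀} {x : X₁₀ ⟶ X₁₁} {y : X₁₁ ⟶ X₁₀} {q' : X₁₀ ⟶ X₁₂} {r'' : X₁₂ ⟶ X₈} {m : X₄ ⟶ X₁₂}
    (n₁ : f ≫ p ≫ q ≫ r ≫ s = c ≫ g) (st : s ≫ t = 𝟙 _) (hr : r ≫ r' = m ≫ r'')
    (n₂ : l ≫ q' = q ≫ m) (xy : x ≫ y = 𝟙 _) :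
    c ≫ g ≫ t ≫ r' ≫ s' = (f ≫ p ≫ l ≫ x) ≫ y ≫ q' ≫ r'' ≫ s' := by
  simp only [Category.assoc]
  rw [reassoc_of% xy, reassoc_of% n₂, ← reassoc_of% hr, ← reassoc_of% n₁, reassoc_of% st]

/-- Natural transformations on a derived category are determined on complexes, where the identity is
`h` in each degree; `comp_eq_of_comp_eq` does the diagram chase. -/
lemma derivedComp_comp {A B C E : Type (u + 1)} [Category.{u} A] [Abelian A] [Category.{u} B]
    [Abelian B] [Category.{u} C] [Abelian C] [Category.{u} E] [Abelian E] [HasDerivedCategory.{w} A]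
    [HasDerivedCategory.{w} B] [HasDerivedCategory.{w} C] [HasDerivedCategory.{w} E]
    {F₁ : A ⥤ B} {F₂ : B ⥤ C} {F₃ : C ⥤ E} {F₁₂ : A ⥤ C} {F₂₃ : B ⥤ E} {T : A ⥤ E}
    [F₁.Additive] [PreservesFiniteLimits F₁] [PreservesFiniteColimits F₁]
    [F₂.Additive] [PreservesFiniteLimits F₂] [PreservesFiniteColimits F₂]
    [F₃.Additive] [PreservesFiniteLimits F₃] [PreservesFiniteColimits F₃]
    [F₁₂.Additive] [PreservesFiniteLimits F₁₂] [PreservesFiniteColimits F₁₂]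
    [F₂₃.Additive] [PreservesFiniteLimits F₂₃] [PreservesFiniteColimits F₂₃]
    [T.Additive] [PreservesFiniteLimits T] [PreservesFiniteColimits T]
    (e₁₂ : F₁ ⋙ F₂ ≅ F₁₂) (e₂₃ : F₂ ⋙ F₃ ≅ F₂₃) (e : F₁₂ ⋙ F₃ ≅ T) (e' : F₁ ⋙ F₂₃ ≅ T)
    (h : ∀ M, e₂₃.hom.app (F₁.obj M) ≫ e'.hom.app M = F₃.map (e₁₂.hom.app M) ≫ e.hom.app M)
    (M : DerivedCategory.{w} A) :
    (derivedComp e₂₃).hom.app (F₁.mapDerivedCategory.obj M) ≫ (derivedComp e').hom.app M =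
      F₃.mapDerivedCategory.map ((derivedComp e₁₂).hom.app M) ≫ (derivedComp e).hom.app M := by
  have key : Functor.whiskerLeft F₁.mapDerivedCategory (derivedComp e₂₃).hom ≫
      (derivedComp e').hom = (Functor.associator _ _ _).inv ≫
        Functor.whiskerRight (derivedComp e₁₂).hom F₃.mapDerivedCategory ≫
          (derivedComp e).hom := by
    apply Localization.natTrans_ext DerivedCategory.Q
      (HomologicalComplex.quasiIso A (ComplexShape.up ℤ))
    intro K
    have h' : (NatTrans.mapHomologicalComplex e₂₃.hom (ComplexShape.up ℤ)).app
        ((F₁.mapHomologicalComplex (ComplexShape.up ℤ)).obj K) ≫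
          (NatTrans.mapHomologicalComplex e'.hom (ComplexShape.up ℤ)).app K =
        (F₃.mapHomologicalComplex (ComplexShape.up ℤ)).map
          ((NatTrans.mapHomologicalComplex e₁₂.hom (ComplexShape.up ℤ)).app K) ≫
          (NatTrans.mapHomologicalComplex e.hom (ComplexShape.up ℤ)).app K := by
      ext n
      exact h (K.X n)
    have h'' := (DerivedCategory.Q.map_comp _ _).symm.trans
      ((congrArg DerivedCategory.Q.map h').trans (DerivedCategory.Q.map_comp _ _))
    have n₁ := (F₃.mapDerivedCategory.map (F₂.mapDerivedCategory.map
      (F₁.mapDerivedCategoryFactors.hom.app K)) ≫= derivedComp_hom_app_Q e₂₃ _).symm.trans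
        ((derivedComp e₂₃).hom.naturality (F₁.mapDerivedCategoryFactors.hom.app K))
    have n₂ := F₃.mapDerivedCategoryFactors.hom.naturality
      ((NatTrans.mapHomologicalComplex e₁₂.hom (ComplexShape.up ℤ)).app K)
    have n₃ : F₃.mapDerivedCategory.map ((derivedComp e₁₂).hom.app (DerivedCategory.Q.obj K)) =
        F₃.mapDerivedCategory.map (F₂.mapDerivedCategory.map
          (F₁.mapDerivedCategoryFactors.hom.app K)) ≫
        F₃.mapDerivedCategory.map (F₂.mapDerivedCategoryFactors.hom.app
          ((F₁.mapHomologicalComplex (ComplexShape.up ℤ)).obj K)) ≫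
        F₃.mapDerivedCategory.map (DerivedCategory.Q.map
          ((NatTrans.mapHomologicalComplex e₁₂.hom (ComplexShape.up ℤ)).app K)) ≫
        F₃.mapDerivedCategory.map (F₁₂.mapDerivedCategoryFactors.inv.app K) := by
      rw [derivedComp_hom_app_Q, Functor.map_comp, Functor.map_comp, Functor.map_comp]
    have n₄ := (F₃.mapDerivedCategory.map_comp _ _).symm.trans ((congrArg F₃.mapDerivedCategory.map
      (F₁₂.mapDerivedCategoryFactors.inv_hom_id_app K)).trans (F₃.mapDerivedCategory.map_id _))
    refine (congrArg (_ ≫ ·) (derivedComp_hom_app_Q e' K)).trans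
      (Eq.trans ?_ (Category.id_comp _).symm)
    refine Eq.trans ?_ (congrArg₂ (· ≫ ·) n₃ (derivedComp_hom_app_Q e K)).symm
    exact comp_eq_of_comp_eq n₁ (F₂₃.mapDerivedCategoryFactors.inv_hom_id_app _) h'' n₂ n₄
  exact (NatTrans.congr_app key M).trans (Category.id_comp _)

/-! ### Morphisms from the homology of closed subspaces -/

section Transport

variable [HasDerivedCategory.{w} AddCommGrpCat.{u}]
  [∀ X : TopCat.{u}, HasDerivedCategory.{w} (Shv X)] {X : TopCat.{u}}

/-- The isomorphism `f⁻¹ π_Y⁻¹ = π_X⁻¹` on derived categories. -/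
abbrev derivedConstantIso {X Y : TopCat.{u}} (f : X ⟶ Y) :
    derivedConstant.{w} Y ⋙ derivedInverseImage f ≅ derivedConstant X :=
  derivedComp (constantInverseImage f)

/-- The isomorphism of functors underlying `restrictIso`. -/
abbrev restrictNatIso {S T : Set X} (h : S ⊆ T) :
    derivedInverseImage.{w} (incl T) ⋙ derivedInverseImage (inclOfSubset h) ≅
      derivedInverseImage (incl S) :=
  derivedComp (inverseImageComp (inclOfSubset h) (incl T) (incl S) rfl)

lemma restrictNatIso_hom_app_derivedConstant {S T : Set X} (h : S ⊆ T)
    (M : DerivedCategory.{w} AddCommGrpCat.{u}) :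
    (restrictNatIso h).hom.app ((derivedConstant X).obj M) ≫
        (derivedConstantIso (incl S)).hom.app M =
      (derivedInverseImage (inclOfSubset h)).map ((derivedConstantIso (incl T)).hom.app M) ≫
        (derivedConstantIso (inclOfSubset h)).hom.app M :=
  derivedComp_comp _ _ _ _ (inverseImageComp_hom_app_constant _ _ _ _) M

lemma homEquiv_mapL_comp {X Y : TopCat.{u}} [HasHomology.{w} X] [HasHomology.{w} Y] (f : X ⟶ Y)
    (F : D.{w} Y) {M : DerivedCategory.{w} AddCommGrpCat.{u}} (g : (L Y).obj F ⟶ M) :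
    (adjL X).homEquiv _ _ (mapL f F ≫ g) =
      (derivedInverseImage f).map ((adjL Y).homEquiv _ _ g) ≫
        (derivedConstantIso f).hom.app M := by
  rw [Adjunction.homEquiv_naturality_right, mapL, Equiv.apply_symm_apply, Category.assoc,
    Adjunction.homEquiv_unit, Functor.map_comp, Category.assoc]
  exact congrArg _ ((derivedConstantIso f).hom.naturality g).symm

/-- The morphism `𝕃(S, F|_S) ⟶ 𝕃(T, F|_T)` for `S ⊆ T ⊆ X`. -/
def subsetL {S T : Set X} (h : S ⊆ T) [HasHomology.{w} (TopCat.of S)]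
    [HasHomology.{w} (TopCat.of T)] (F : D.{w} X) :
    (L (TopCat.of S)).obj (restrict S F) ⟶ (L (TopCat.of T)).obj (restrict T F) :=
  (L (TopCat.of S)).map (restrictIso h F).inv ≫ mapL (inclOfSubset h) (restrict T F)

lemma homologyFunctor_map_subsetL (i : ℤ) {S T : Set X} (h : S ⊆ T) [HasHomology.{w} (TopCat.of S)]
    [HasHomology.{w} (TopCat.of T)] (F : D.{w} X) :
    (DerivedCategory.homologyFunctor AddCommGrpCat.{u} (-i)).map (subsetL h F) =
      fromSubset i h F :=
  Functor.map_comp _ _ _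

/-- Morphisms from `𝕃(S, F|_S)` to `M` correspond to morphisms from `F` to `i_* i⁻¹ π_X⁻¹ M`, where
`i` is the inclusion of `S`. -/
def supportEquiv (S : Set X) [Fact (IsClosed S)] [HasHomology.{w} (TopCat.of S)] (F : D.{w} X)
    (M : DerivedCategory.{w} AddCommGrpCat.{u}) :
    ((L (TopCat.of S)).obj (restrict S F) ⟶ M) ≃
      (F ⟶ (derivedSupport S).obj ((derivedConstant X).obj M)) :=
  ((adjL (TopCat.of S)).homEquiv _ _).trans
    ((((derivedConstantIso (incl S)).app M).symm.homToEquiv).trans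
      ((closedAdj S).homEquiv F ((derivedInverseImage (incl S)).obj ((derivedConstant X).obj M))))

lemma supportEquiv_apply (S : Set X) [Fact (IsClosed S)] [HasHomology.{w} (TopCat.of S)]
    (F : D.{w} X) {M : DerivedCategory.{w} AddCommGrpCat.{u}}
    (x : (L (TopCat.of S)).obj (restrict S F) ⟶ M) :
    supportEquiv S F M x = (closedAdj S).unit.app F ≫
      (directImage (incl S)).mapDerivedCategory.map
        ((adjL (TopCat.of S)).homEquiv _ _ x ≫ (derivedConstantIso (incl S)).inv.app M) :=
  (closedAdj S).homEquiv_unit _ _ _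

lemma supportEquiv_comp (S : Set X) [Fact (IsClosed S)] [HasHomology.{w} (TopCat.of S)]
    (F : D.{w} X) {M N : DerivedCategory.{w} AddCommGrpCat.{u}}
    (x : (L (TopCat.of S)).obj (restrict S F) ⟶ M) (m : M ⟶ N) :
    supportEquiv S F N (x ≫ m) =
      supportEquiv S F M x ≫ (derivedSupport S).map ((derivedConstant X).map m) := by
  rw [supportEquiv_apply, supportEquiv_apply, Adjunction.homEquiv_naturality_right, Category.assoc,
    Category.assoc]
  refine congrArg _ (Eq.trans ?_ (Functor.map_comp _ _ _))
  rw [Category.assoc]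
  exact congrArg (fun t ↦ (directImage (incl S)).mapDerivedCategory.map (_ ≫ t))
    ((derivedConstantIso (incl S)).inv.naturality m)

lemma supportEquiv_sub (S : Set X) [Fact (IsClosed S)] [HasHomology.{w} (TopCat.of S)]
    (F : D.{w} X) {M : DerivedCategory.{w} AddCommGrpCat.{u}}
    (x y : (L (TopCat.of S)).obj (restrict S F) ⟶ M) :
    supportEquiv S F M (x - y) = supportEquiv S F M x - supportEquiv S F M y := by
  simp only [supportEquiv_apply, Adjunction.homEquiv_unit, Functor.map_sub, Preadditive.comp_sub,
    Preadditive.sub_comp]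

/-- Precomposition with the map `𝕃(S, F|_S) ⟶ 𝕃(X, F)` becomes composition with the first map of the
triangle. -/
lemma supportEquiv_mapL_comp [HasHomology.{w} X] (S : Set X) [Fact (IsClosed S)]
    [HasHomology.{w} (TopCat.of S)] (F : D.{w} X) {M : DerivedCategory.{w} AddCommGrpCat.{u}}
    (g : (L X).obj F ⟶ M) :
    supportEquiv S F M (mapL (incl S) F ≫ g) =
      (adjL X).homEquiv _ _ g ≫ (closedAdj S).unit.app ((derivedConstant X).obj M) := by
  rw [supportEquiv_apply, homEquiv_mapL_comp, Category.assoc]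
  refine Eq.trans ?_ ((closedAdj S).unit.naturality ((adjL X).homEquiv _ _ g)).symm
  refine congrArg (fun t ↦ _ ≫ (directImage (incl S)).mapDerivedCategory.map t) ?_
  exact (congrArg _ ((derivedConstantIso (incl S)).hom_inv_id_app M)).trans (Category.comp_id _)

/-- `unit_map_comp` moves the restriction past the adjunctions; what remains is the coherence
between the identifications of constant sheaves on `X`, `T` and `S`. -/
lemma supportEquiv_subsetL_comp {S T : Set X} (h : S ⊆ T) [Fact (IsClosed S)] [Fact (IsClosed T)]
    [HasHomology.{w} (TopCat.of S)] [HasHomology.{w} (TopCat.of T)] (F : D.{w} X)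
    {M : DerivedCategory.{w} AddCommGrpCat.{u}}
    (x : (L (TopCat.of T)).obj (restrict T F) ⟶ M) :
    supportEquiv S F M (subsetL h F ≫ x) =
      supportEquiv T F M x ≫ (derivedSupportMap h).app ((derivedConstant X).obj M) := by
  rw [supportEquiv_apply, supportEquiv_apply, Category.assoc]
  refine Eq.trans ?_ (unit_map_comp (closedAdj T) (closedAdj S) (restrictNatIso h)
    ((derivedSupportMap h).app ((derivedConstant X).obj M)) (unit_derivedSupportMap h _) _).symm
  refine congrArg (fun t ↦ _ ≫ (directImage (incl S)).mapDerivedCategory.map t) ?_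
  rw [subsetL, Category.assoc, Adjunction.homEquiv_naturality_left, homEquiv_mapL_comp]
  have h₁ := restrictNatIso_hom_app_derivedConstant h M
  have h₂ : (derivedConstantIso (inclOfSubset h)).hom.app M ≫
      (derivedConstantIso (incl S)).inv.app M =
        (derivedInverseImage (inclOfSubset h)).map ((derivedConstantIso (incl T)).inv.app M) ≫
          (restrictNatIso h).hom.app ((derivedConstant X).obj M) := by
    refine (Iso.comp_inv_eq ((derivedConstantIso (incl S)).app M)).2 ?_
    refine Eq.trans ?_ (Category.assoc _ _ _).symm
    refine Eq.trans ?_ (congrArg _ h₁).symm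
    rw [← Functor.map_comp_assoc]
    exact ((congrArg (fun t ↦ (derivedInverseImage (inclOfSubset h)).map t ≫ _)
      ((derivedConstantIso (incl T)).inv_hom_id_app M)).trans
        ((congrArg (· ≫ _) (CategoryTheory.Functor.map_id _ _)).trans (Category.id_comp _))).symm
  rw [Functor.map_comp, Category.assoc, Category.assoc, Category.assoc]
  exact congrArg (fun t ↦ _ ≫ _ ≫ t) h₂

/-! ### The connecting morphism -/

variable {Y Z : Set X} [hY : Fact (IsClosed Y)] [hZ : Fact (IsClosed Z)] [HasHomology.{w} X]
  [HasHomology.{w} (TopCat.of ↥(Y ∩ Z))]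

/-- Under `supportEquiv`, functoriality for `S ⊆ T ⊆ X` is the compatibility of restriction with the
units. -/
lemma subsetL_comp_mapL {S T : Set X} (h : S ⊆ T) [Fact (IsClosed S)] [Fact (IsClosed T)]
    [HasHomology.{w} (TopCat.of S)] [HasHomology.{w} (TopCat.of T)] (F : D.{w} X) :
    subsetL h F ≫ mapL (incl T) F = mapL (incl S) F := by
  apply (supportEquiv S F _).injective
  rw [supportEquiv_subsetL_comp, ← Category.comp_id (mapL (incl T) F),
    ← Category.comp_id (mapL (incl S) F), supportEquiv_mapL_comp, supportEquiv_mapL_comp,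
    Category.assoc, unit_derivedSupportMap]

lemma exists_mapL_comp_eq [HasHomology.{w} (TopCat.of Y)] [HasHomology.{w} (TopCat.of Z)]
    (hYZ : Y ∪ Z = Set.univ) (F : D.{w} X)
    {M : DerivedCategory.{w} AddCommGrpCat.{u}}
    (x : (L (TopCat.of Y)).obj (restrict Y F) ⟶ M) (y : (L (TopCat.of Z)).obj (restrict Z F) ⟶ M)
    (h : subsetL (Set.inter_subset_left : Y ∩ Z ⊆ Y) F ≫ x =
      subsetL (Set.inter_subset_right : Y ∩ Z ⊆ Z) F ≫ y) :
    ∃ g : (L X).obj F ⟶ M, mapL (incl Y) F ≫ g = x ∧ mapL (incl Z) F ≫ g = y := by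
  have h' := congrArg (supportEquiv (Y ∩ Z) F M) h
  rw [supportEquiv_subsetL_comp, supportEquiv_subsetL_comp] at h'
  obtain ⟨g, h₁, h₂⟩ := exists_lift_of_comp_derivedSupportMap_eq hYZ _ _ h'
  obtain ⟨g, rfl⟩ := ((adjL X).homEquiv _ _).surjective g
  refine ⟨g, (supportEquiv Y F M).injective ?_, (supportEquiv Z F M).injective ?_⟩
  · rw [supportEquiv_mapL_comp, h₁]
  · rw [supportEquiv_mapL_comp, h₂]

/-- The connecting morphism of the Mayer-Vietoris sequence in homology. -/
def connectingL (hYZ : Y ∪ Z = Set.univ) (F : D.{w} X) : (L X).obj F ⟶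
    ((L (TopCat.of ↥(Y ∩ Z))).obj (restrict (Y ∩ Z) F))⟦(1 : ℤ)⟧ :=
  ((adjL X).homEquiv _ _).symm (supportEquiv (Y ∩ Z) F _ (𝟙 _) ≫ (mayerVietorisδ hYZ).app _ ≫
    ((derivedConstant X).commShiftIso (1 : ℤ)).inv.app _)

/-- Naturality of `δ` extends the definition of `connectingL` from the identity to every `a`; hence
exactness statements about `δ` transfer to `connectingL`. -/
lemma homEquiv_connectingL_comp (hYZ : Y ∪ Z = Set.univ) (F : D.{w} X)
    {M : DerivedCategory.{w} AddCommGrpCat.{u}}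
    (a : (L (TopCat.of ↥(Y ∩ Z))).obj (restrict (Y ∩ Z) F) ⟶ M) :
    (adjL X).homEquiv _ _ (connectingL hYZ F ≫ a⟦(1 : ℤ)⟧') =
      supportEquiv (Y ∩ Z) F M a ≫ (mayerVietorisδ hYZ).app _ ≫
        ((derivedConstant X).commShiftIso (1 : ℤ)).inv.app _ := by
  rw [Adjunction.homEquiv_naturality_right, connectingL, Equiv.apply_symm_apply, Category.assoc,
    Category.assoc]
  have h := supportEquiv_comp (Y ∩ Z) F (𝟙 _) a
  rw [Category.id_comp] at h
  rw [h, Category.assoc]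
  refine congrArg _ ?_
  rw [NatTrans.naturality_assoc]
  exact congrArg _ (((derivedConstant X).commShiftIso (1 : ℤ)).inv.naturality a).symm

lemma connectingL_comp_shift_eq_zero_iff (hYZ : Y ∪ Z = Set.univ) (F : D.{w} X)
    {M : DerivedCategory.{w} AddCommGrpCat.{u}}
    (a : (L (TopCat.of ↥(Y ∩ Z))).obj (restrict (Y ∩ Z) F) ⟶ M) :
    connectingL hYZ F ≫ a⟦(1 : ℤ)⟧' = 0 ↔
      supportEquiv (Y ∩ Z) F M a ≫ (mayerVietorisδ hYZ).app _ = 0 := by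
  have h₀ : (adjL X).homEquiv F (M⟦(1 : ℤ)⟧) 0 = 0 := by
    rw [Adjunction.homEquiv_unit, Functor.map_zero, comp_zero]
  rw [← ((adjL X).homEquiv _ _).injective.eq_iff, homEquiv_connectingL_comp, h₀, ← Category.assoc]
  exact ⟨fun h ↦ (cancel_mono (((derivedConstant X).commShiftIso (1 : ℤ)).inv.app M)).1
    (h.trans zero_comp.symm), fun h ↦ (h =≫ _).trans zero_comp⟩

lemma connectingL_comp_shift_subsetL [HasHomology.{w} (TopCat.of Y)]
    [HasHomology.{w} (TopCat.of Z)] (hYZ : Y ∪ Z = Set.univ) (F : D.{w} X) :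
    connectingL hYZ F ≫ (subsetL (Set.inter_subset_left : Y ∩ Z ⊆ Y) F)⟦(1 : ℤ)⟧' = 0 ∧
      connectingL hYZ F ≫ (subsetL (Set.inter_subset_right : Y ∩ Z ⊆ Z) F)⟦(1 : ℤ)⟧' = 0 := by
  constructor
  · rw [connectingL_comp_shift_eq_zero_iff,
      ← Category.comp_id (subsetL (Set.inter_subset_left : Y ∩ Z ⊆ Y) F),
      supportEquiv_subsetL_comp, Category.assoc, (derivedSupportMap_comp_δ hYZ _).1, comp_zero]
  · rw [connectingL_comp_shift_eq_zero_iff,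
      ← Category.comp_id (subsetL (Set.inter_subset_right : Y ∩ Z ⊆ Z) F),
      supportEquiv_subsetL_comp, Category.assoc, (derivedSupportMap_comp_δ hYZ _).2, comp_zero]

lemma exists_of_connectingL_comp_shift_eq_zero [HasHomology.{w} (TopCat.of Y)]
    [HasHomology.{w} (TopCat.of Z)] (hYZ : Y ∪ Z = Set.univ) (F : D.{w} X)
    {M : DerivedCategory.{w} AddCommGrpCat.{u}}
    (a : (L (TopCat.of ↥(Y ∩ Z))).obj (restrict (Y ∩ Z) F) ⟶ M)
    (ha : connectingL hYZ F ≫ a⟦(1 : ℤ)⟧' = 0) :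
    ∃ (x : (L (TopCat.of Y)).obj (restrict Y F) ⟶ M)
      (y : (L (TopCat.of Z)).obj (restrict Z F) ⟶ M),
      a = subsetL (Set.inter_subset_left : Y ∩ Z ⊆ Y) F ≫ x -
        subsetL (Set.inter_subset_right : Y ∩ Z ⊆ Z) F ≫ y := by
  obtain ⟨x, y, h⟩ := exists_of_comp_mayerVietorisδ_eq_zero hYZ _
    ((connectingL_comp_shift_eq_zero_iff hYZ F a).1 ha)
  obtain ⟨x, rfl⟩ := (supportEquiv Y F M).surjective x
  obtain ⟨y, rfl⟩ := (supportEquiv Z F M).surjective y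
  refine ⟨x, y, (supportEquiv (Y ∩ Z) F M).injective ?_⟩
  rw [h, supportEquiv_sub, supportEquiv_subsetL_comp, supportEquiv_subsetL_comp]

lemma mapL_comp_eq_zero_iff (S : Set X) [HasHomology.{w} (TopCat.of S)] (F : D.{w} X)
    {M : DerivedCategory.{w} AddCommGrpCat.{u}} (x : (L X).obj F ⟶ M) :
    mapL (incl S) F ≫ x = 0 ↔
      (derivedInverseImage (incl S)).map ((adjL X).homEquiv _ _ x) = 0 := by
  have h₀ : (adjL (TopCat.of S)).homEquiv (restrict S F) M 0 = 0 := by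
    rw [Adjunction.homEquiv_unit, Functor.map_zero, comp_zero]
  rw [← ((adjL (TopCat.of S)).homEquiv _ _).injective.eq_iff, homEquiv_mapL_comp, h₀]
  exact ⟨fun h ↦ (cancel_mono ((derivedConstantIso (incl S)).hom.app M)).1
    (h.trans zero_comp.symm), fun h ↦ (h =≫ _).trans zero_comp⟩

lemma mapL_comp_connectingL [HasHomology.{w} (TopCat.of Y)]
    [HasHomology.{w} (TopCat.of Z)] (hYZ : Y ∪ Z = Set.univ) (F : D.{w} X) :
    mapL (incl Y) F ≫ connectingL hYZ F = 0 ∧ mapL (incl Z) F ≫ connectingL hYZ F = 0 := by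
  constructor
  · rw [mapL_comp_eq_zero_iff, connectingL, Equiv.apply_symm_apply, Functor.map_comp,
      Functor.map_comp, (derivedInverseImage_map_mayerVietorisδ hYZ _).1, zero_comp, comp_zero]
  · rw [mapL_comp_eq_zero_iff, connectingL, Equiv.apply_symm_apply, Functor.map_comp,
      Functor.map_comp, (derivedInverseImage_map_mayerVietorisδ hYZ _).2, zero_comp, comp_zero]

lemma exists_connectingL_comp_eq [HasHomology.{w} (TopCat.of Y)]
    [HasHomology.{w} (TopCat.of Z)] (hYZ : Y ∪ Z = Set.univ) (F : D.{w} X)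
    {M : DerivedCategory.{w} AddCommGrpCat.{u}} (x : (L X).obj F ⟶ M⟦(1 : ℤ)⟧)
    (h₁ : mapL (incl Y) F ≫ x = 0) (h₂ : mapL (incl Z) F ≫ x = 0) :
    ∃ a : (L (TopCat.of ↥(Y ∩ Z))).obj (restrict (Y ∩ Z) F) ⟶ M,
      connectingL hYZ F ≫ a⟦(1 : ℤ)⟧' = x := by
  rw [mapL_comp_eq_zero_iff] at h₁ h₂
  obtain ⟨c, hc⟩ := exists_comp_mayerVietorisδ_eq hYZ ((adjL X).homEquiv _ _ x ≫
    ((derivedConstant X).commShiftIso (1 : ℤ)).hom.app M)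
    (by rw [Functor.map_comp, h₁, zero_comp]) (by rw [Functor.map_comp, h₂, zero_comp])
  obtain ⟨a, rfl⟩ := (supportEquiv (Y ∩ Z) F M).surjective c
  refine ⟨a, ((adjL X).homEquiv _ _).injective ?_⟩
  rw [homEquiv_connectingL_comp, reassoc_of% hc, Iso.hom_inv_id_app]
  exact Category.comp_id _

end Transport

/-! ### Exactness in cohomology -/

lemma exists_injective_hom_ne_zero {G : AddCommGrpCat.{u}} (N : AddSubgroup G) {g : G}
    (hg : g ∉ N) : ∃ (I : AddCommGrpCat.{u}) (_ : Injective I) (χ : G ⟶ I),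
      (∀ n ∈ N, χ.hom n = 0) ∧ χ.hom g ≠ 0 := by
  let f := Injective.ι (AddCommGrpCat.of (G ⧸ N))
  -- The test map is the quotient by `N` followed by an embedding into an injective group.
  have hf : Function.Injective f.hom := (AddCommGrpCat.mono_iff_injective f).1 inferInstance
  refine ⟨_, inferInstance, AddCommGrpCat.ofHom (QuotientAddGroup.mk' N) ≫ f, fun n hn ↦ ?_,
    fun h ↦ hg ?_⟩
  · have : (QuotientAddGroup.mk' N) n = 0 := (QuotientAddGroup.eq_zero_iff n).2 hn
    exact (congrArg f.hom this).trans (map_zero f.hom)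
  · exact (QuotientAddGroup.eq_zero_iff g).1 (hf (h.trans (map_zero f.hom).symm))

section Homology

open DerivedCategory (homologyFunctor)

variable [HasDerivedCategory.{w} AddCommGrpCat.{u}]

lemma exists_hom_derivedSingle_ne_zero {K : DerivedCategory.{w} AddCommGrpCat.{u}} {n : ℤ}
    (N : AddSubgroup ((homologyFunctor AddCommGrpCat.{u} n).obj K))
    {g : (homologyFunctor AddCommGrpCat.{u} n).obj K} (hg : g ∉ N) :
    ∃ (I : AddCommGrpCat.{u}) (_ : Injective I) (x : K ⟶ derivedSingle I n),
      (∀ c ∈ N, ((homologyFunctor AddCommGrpCat.{u} n).map x).hom c = 0) ∧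
        ((homologyFunctor AddCommGrpCat.{u} n).map x).hom g ≠ 0 := by
  obtain ⟨I, hI, χ, h₁, h₂⟩ := exists_injective_hom_ne_zero N hg
  obtain ⟨x, hx⟩ := exists_homologyFunctor_map_eq χ
  have hx' : (homologyFunctor AddCommGrpCat.{u} n).map x =
      χ ≫ (homologyDerivedSingleIso I n).inv := by rw [← hx, Category.assoc, Iso.hom_inv_id,
        Category.comp_id]
  refine ⟨I, hI, x, fun c hc ↦ ?_, fun h ↦ h₂ ?_⟩
  · rw [hx']
    exact (congrArg (homologyDerivedSingleIso I n).inv.hom (h₁ c hc)).trans (map_zero _)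
  · rw [← hx]
    exact (congrArg (homologyDerivedSingleIso I n).hom.hom h).trans (map_zero _)

lemma exists_iso_shift (M : DerivedCategory.{w} AddCommGrpCat.{u}) :
    ∃ M' : DerivedCategory.{w} AddCommGrpCat.{u}, Nonempty (M ≅ M'⟦(1 : ℤ)⟧) :=
  ⟨M⟦(-1 : ℤ)⟧, ⟨(shiftNegShift M (1 : ℤ)).symm⟩⟩

/-- Every object is a shift and the shift is full, so `x` desuspends to a map into `derivedSingle I
n`. -/
lemma eq_zero_of_shiftMap_eq_zero {I : AddCommGrpCat.{u}} [Injective I] {n n' : ℤ}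
    (hn : 1 + n' = n) {K : DerivedCategory.{w} AddCommGrpCat.{u}}
    (x : K ⟶ (derivedSingle I n)⟦(1 : ℤ)⟧)
    (hx : (homologyFunctor AddCommGrpCat.{u} 0).shiftMap x n' n hn = 0) :
    x = 0 := by
  obtain ⟨K', ⟨e⟩⟩ := exists_iso_shift K
  obtain ⟨y, hy⟩ := (shiftFunctor (DerivedCategory.{w} AddCommGrpCat.{u}) (1 : ℤ)).map_surjective
    (e.inv ≫ x)
  have h : (homologyFunctor AddCommGrpCat.{u} 0).shiftMap (e.inv ≫ x) n' n hn = 0 := by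
    rw [Functor.shiftMap_comp', hx, comp_zero]
  rw [← hy] at h
  have h' := (Functor.shiftIso_hom_naturality (homologyFunctor AddCommGrpCat.{u} 0)
    1 n' n hn y).symm.trans h
  have h₀ : y = 0 := by
    apply eq_zero_of_homologyFunctor_map_eq_zero
    exact (cancel_epi (((homologyFunctor AddCommGrpCat.{u} 0).shiftIso 1 n' n hn).hom.app K')).1
      (h'.trans comp_zero.symm)
  rw [← cancel_epi e.inv, ← hy, h₀, Functor.map_zero, comp_zero]

variable {K₀ K₁ K₂ K₃ : DerivedCategory.{w} AddCommGrpCat.{u}} {k : K₀ ⟶ K₁} {l : K₀ ⟶ K₂}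
  {p : K₁ ⟶ K₃} {q : K₂ ⟶ K₃} {d : K₃ ⟶ K₀⟦(1 : ℤ)⟧} {n' n : ℤ} (hn : 1 + n' = n)

lemma homology_exact_connecting
    (h₁ : d ≫ k⟦(1 : ℤ)⟧' = 0) (h₂ : d ≫ l⟦(1 : ℤ)⟧' = 0)
    (h : ∀ ⦃M : DerivedCategory.{w} AddCommGrpCat.{u}⦄ (a : K₀ ⟶ M), d ≫ a⟦(1 : ℤ)⟧' = 0 →
      ∃ (x : K₁ ⟶ M) (y : K₂ ⟶ M), a = k ≫ x - l ≫ y) :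
    Function.Exact ((homologyFunctor AddCommGrpCat.{u} 0).shiftMap d n' n hn).hom
      (((homologyFunctor AddCommGrpCat.{u} n).map k).hom.prod (-((homologyFunctor AddCommGrpCat.{u} n).map l).hom)) := by
  intro b
  constructor
  · intro hb
    by_contra hb'
    -- A test map that kills the image of the connecting map but not `b`. Then `d ≫ a⟦1⟧` vanishes,
    -- so `a` factors through `k` and `l`, which kill `b`.
    obtain ⟨I, hI, a, ha, hab⟩ := exists_hom_derivedSingle_ne_zero
      ((homologyFunctor AddCommGrpCat.{u} 0).shiftMap d n' n hn).hom.range (g := b) hb'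
    have : d ≫ a⟦(1 : ℤ)⟧' = 0 := by
      apply eq_zero_of_shiftMap_eq_zero hn
      rw [Functor.shiftMap_comp]
      ext c
      exact ha _ ⟨c, rfl⟩
    obtain ⟨x, y, rfl⟩ := h a this
    have hk : ((homologyFunctor AddCommGrpCat.{u} n).map k).hom b = 0 := congrArg Prod.fst hb
    have hl : ((homologyFunctor AddCommGrpCat.{u} n).map l).hom b = 0 := neg_eq_zero.1 (congrArg Prod.snd hb)
    apply hab
    rw [Functor.map_sub, Functor.map_comp, Functor.map_comp]
    change ((homologyFunctor AddCommGrpCat.{u} n).map x).hom (((homologyFunctor AddCommGrpCat.{u} n).map k).hom b) -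
      ((homologyFunctor AddCommGrpCat.{u} n).map y).hom (((homologyFunctor AddCommGrpCat.{u} n).map l).hom b) = 0
    rw [hk, hl, map_zero, map_zero, sub_zero]
  · rintro ⟨c, rfl⟩
    have e₁ := (homologyFunctor AddCommGrpCat.{u} 0).shiftMap_comp d k n' n hn
    have e₂ := (homologyFunctor AddCommGrpCat.{u} 0).shiftMap_comp d l n' n hn
    rw [h₁, Functor.shiftMap_zero] at e₁
    rw [h₂, Functor.shiftMap_zero] at e₂
    refine Prod.ext (ConcreteCategory.congr_hom e₁ c).symm
      (neg_eq_zero.2 (ConcreteCategory.congr_hom e₂ c).symm)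

lemma homology_exact_middle (w : k ≫ p = l ≫ q)
    (h : ∀ ⦃M : DerivedCategory.{w} AddCommGrpCat.{u}⦄ (x : K₁ ⟶ M) (y : K₂ ⟶ M),
      k ≫ x = l ≫ y → ∃ g : K₃ ⟶ M, p ≫ g = x ∧ q ≫ g = y) (n : ℤ) :
    Function.Exact (((homologyFunctor AddCommGrpCat.{u} n).map k).hom.prod (-((homologyFunctor AddCommGrpCat.{u} n).map l).hom))
      (((homologyFunctor AddCommGrpCat.{u} n).map p).hom.coprod ((homologyFunctor AddCommGrpCat.{u} n).map q).hom) := by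
  rintro ⟨b, c⟩
  constructor
  · intro hbc
    by_contra hbc'
    -- Separate `(b, c)` from the image in the product group; both components of `χ` lift to the
    -- derived category and glue to one map from `K₃`.
    obtain ⟨I, hI, χ, h₁, h₂⟩ := exists_injective_hom_ne_zero
      (G := AddCommGrpCat.of ((homologyFunctor AddCommGrpCat.{u} n).obj K₁ × (homologyFunctor AddCommGrpCat.{u} n).obj K₂))
      (((homologyFunctor AddCommGrpCat.{u} n).map k).hom.prod (-((homologyFunctor AddCommGrpCat.{u} n).map l).hom)).range (g := (b, c)) hbc'
    obtain ⟨x, hx⟩ := exists_homologyFunctor_map_eq (K := K₁) (n := n)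
      (AddCommGrpCat.ofHom (χ.hom.comp (AddMonoidHom.inl _ _)))
    obtain ⟨y, hy⟩ := exists_homologyFunctor_map_eq (K := K₂) (n := n)
      (AddCommGrpCat.ofHom (χ.hom.comp (AddMonoidHom.inr _ _)))
    have hxy : k ≫ x = l ≫ y := by
      rw [← sub_eq_zero]
      apply eq_zero_of_homologyFunctor_map_eq_zero
      rw [← cancel_mono (homologyDerivedSingleIso I n).hom, Functor.map_sub, Functor.map_comp,
        Functor.map_comp, Preadditive.sub_comp, Category.assoc, Category.assoc, hx, hy, zero_comp]
      ext e
      have := h₁ _ ⟨e, rfl⟩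
      change χ.hom (((homologyFunctor AddCommGrpCat.{u} n).map k).hom e, 0) - χ.hom (0, ((homologyFunctor AddCommGrpCat.{u} n).map l).hom e) = 0
      rw [← map_sub]
      simpa using this
    obtain ⟨g, rfl, rfl⟩ := h x y hxy
    apply h₂
    have hb : ((homologyDerivedSingleIso I n).hom.hom (((homologyFunctor AddCommGrpCat.{u} n).map g).hom
        (((homologyFunctor AddCommGrpCat.{u} n).map p).hom b))) = χ.hom (b, 0) := by
      rw [Functor.map_comp] at hx
      exact ConcreteCategory.congr_hom hx b
    have hc : ((homologyDerivedSingleIso I n).hom.hom (((homologyFunctor AddCommGrpCat.{u} n).map g).hom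
        (((homologyFunctor AddCommGrpCat.{u} n).map q).hom c))) = χ.hom (0, c) := by
      rw [Functor.map_comp] at hy
      exact ConcreteCategory.congr_hom hy c
    have hbc'' : ((homologyFunctor AddCommGrpCat.{u} n).map p).hom b + ((homologyFunctor AddCommGrpCat.{u} n).map q).hom c = 0 := hbc
    have e : ((b, c) : (homologyFunctor AddCommGrpCat.{u} n).obj K₁ × (homologyFunctor AddCommGrpCat.{u} n).obj K₂) = (b, 0) + (0, c) := by simp
    rw [e]
    refine (map_add χ.hom _ _).trans ?_
    rw [← hb, ← hc, ← map_add, ← map_add, hbc'', map_zero, map_zero]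
  · rintro ⟨e, he⟩
    rw [← he]
    have := ConcreteCategory.congr_hom (congrArg (homologyFunctor AddCommGrpCat.{u} n).map w) e
    rw [Functor.map_comp, Functor.map_comp] at this
    change ((homologyFunctor AddCommGrpCat.{u} n).map p).hom (((homologyFunctor AddCommGrpCat.{u} n).map k).hom e) +
      ((homologyFunctor AddCommGrpCat.{u} n).map q).hom (-(((homologyFunctor AddCommGrpCat.{u} n).map l).hom e)) = 0
    rw [map_neg, ← sub_eq_add_neg, sub_eq_zero]
    exact this

lemma homology_exact_last (h₁ : p ≫ d = 0) (h₂ : q ≫ d = 0)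
    (h : ∀ ⦃M : DerivedCategory.{w} AddCommGrpCat.{u}⦄ (x : K₃ ⟶ M⟦(1 : ℤ)⟧),
      p ≫ x = 0 → q ≫ x = 0 → ∃ a : K₀ ⟶ M, d ≫ a⟦(1 : ℤ)⟧' = x) :
    Function.Exact (((homologyFunctor AddCommGrpCat.{u} n').map p).hom.coprod ((homologyFunctor AddCommGrpCat.{u} n').map q).hom)
      ((homologyFunctor AddCommGrpCat.{u} 0).shiftMap d n' n hn).hom := by
  intro c
  constructor
  · intro hc
    by_contra hc'
    obtain ⟨I, hI, x, hx, hxc⟩ := exists_hom_derivedSingle_ne_zero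
      (((homologyFunctor AddCommGrpCat.{u} n').map p).hom.coprod ((homologyFunctor AddCommGrpCat.{u} n').map q).hom).range (g := c) hc'
    -- Desuspending the target puts `x` in the form required by `h`; then `x` factors through `d`,
    -- which kills `c` in homology.
    obtain ⟨M, ⟨e⟩⟩ := exists_iso_shift (derivedSingle I n')
    have hpx : p ≫ x = 0 := by
      apply eq_zero_of_homologyFunctor_map_eq_zero
      rw [Functor.map_comp]
      ext b
      exact hx _ ⟨(b, 0), by simp only [AddMonoidHom.coprod_apply, map_zero, add_zero]; rfl⟩
    have hqx : q ≫ x = 0 := by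
      apply eq_zero_of_homologyFunctor_map_eq_zero
      rw [Functor.map_comp]
      ext b
      exact hx _ ⟨(0, b), by simp only [AddMonoidHom.coprod_apply, map_zero, zero_add]; rfl⟩
    obtain ⟨a, ha⟩ := h (x ≫ e.hom) (by rw [reassoc_of% hpx, zero_comp])
      (by rw [reassoc_of% hqx, zero_comp])
    have h' := (homologyFunctor AddCommGrpCat.{u} 0).shiftMap_comp d a n' n hn
    rw [ha, Functor.shiftMap_comp'] at h'
    have : IsIso ((homologyFunctor AddCommGrpCat.{u} 0).shiftMap e.hom n' n hn) := by
      unfold Functor.shiftMap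
      infer_instance
    have h'' := ConcreteCategory.congr_hom ((IsIso.eq_comp_inv _).2 h') c
    refine hxc (h''.trans ?_)
    exact (congrArg (((homologyFunctor AddCommGrpCat.{u} 0).shift n).map a ≫
      inv ((homologyFunctor AddCommGrpCat.{u} 0).shiftMap e.hom n' n hn)).hom hc).trans (map_zero _)
  · rintro ⟨⟨a, b⟩, rfl⟩
    have e₁ := (homologyFunctor AddCommGrpCat.{u} 0).shiftMap_comp' p d n' n hn
    have e₂ := (homologyFunctor AddCommGrpCat.{u} 0).shiftMap_comp' q d n' n hn
    rw [h₁, Functor.shiftMap_zero] at e₁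
    rw [h₂, Functor.shiftMap_zero] at e₂
    have e₁' := ConcreteCategory.congr_hom e₁ a
    have e₂' := ConcreteCategory.congr_hom e₂ b
    refine (map_add ((homologyFunctor AddCommGrpCat.{u} 0).shiftMap d n' n hn).hom _ _).trans ?_
    exact (congrArg₂ (· + ·) e₁'.symm e₂'.symm).trans (add_zero _)

end Homology

end

end SheafHomology

theorem mainTheorem12
    [HasDerivedCategory.{w} AddCommGrpCat.{u}]
    [∀ X : TopCat.{u}, HasDerivedCategory.{w} (SheafHomology.Shv X)]
    {X : TopCat.{u}} (Y Z : Set X) (hY : IsClosed Y) (hZ : IsClosed Z)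
    (hYZ : Y ∪ Z = Set.univ)
    [SheafHomology.HasHomology.{w} X]
    [SheafHomology.HasHomology.{w} (TopCat.of Y)]
    [SheafHomology.HasHomology.{w} (TopCat.of Z)]
    [SheafHomology.HasHomology.{w} (TopCat.of ↥(Y ∩ Z))]
    (F : SheafHomology.D.{w} X) :
    ∃ δ : ∀ i : ℤ, SheafHomology.H (i + 1) X F →+
        SheafHomology.H i (TopCat.of ↥(Y ∩ Z)) (SheafHomology.restrict (Y ∩ Z) F),
      let α := fun i : ℤ =>
        (SheafHomology.fromSubset i (Set.inter_subset_left : Y ∩ Z ⊆ Y) F).hom.prod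
          (-(SheafHomology.fromSubset i (Set.inter_subset_right : Y ∩ Z ⊆ Z) F).hom)
      let β := fun i : ℤ =>
        (SheafHomology.fromSubspace i Y F).hom.coprod (SheafHomology.fromSubspace i Z F).hom
      ∀ i : ℤ,
        Function.Exact (δ i) (α i) ∧ Function.Exact (α i) (β i) ∧
          Function.Exact (β (i + 1)) (δ i) := by
  have : Fact (IsClosed Y) := ⟨hY⟩
  have : Fact (IsClosed Z) := ⟨hZ⟩
  -- Homology in degree `i + 1` is cohomology in degree `-(i + 1)`, which a map to a shift by one
  -- raises to `-i`.
  have hn (i : ℤ) : 1 + -(i + 1) = -i := by omega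
  refine ⟨fun i ↦ ((DerivedCategory.homologyFunctor AddCommGrpCat.{u} 0).shiftMap
    (SheafHomology.connectingL hYZ F) (-(i + 1)) (-i) (hn i)).hom, fun i ↦ ⟨?_, ?_, ?_⟩⟩
  · have h := SheafHomology.homology_exact_connecting (hn i)
      (SheafHomology.connectingL_comp_shift_subsetL hYZ F).1
      (SheafHomology.connectingL_comp_shift_subsetL hYZ F).2
      (fun _ a ha ↦ SheafHomology.exists_of_connectingL_comp_shift_eq_zero hYZ F a ha)
    rw [SheafHomology.homologyFunctor_map_subsetL, SheafHomology.homologyFunctor_map_subsetL] at h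
    exact h
  · have h := SheafHomology.homology_exact_middle
      ((SheafHomology.subsetL_comp_mapL (Set.inter_subset_left : Y ∩ Z ⊆ Y) F).trans
        (SheafHomology.subsetL_comp_mapL (Set.inter_subset_right : Y ∩ Z ⊆ Z) F).symm)
      (fun _ x y hxy ↦ SheafHomology.exists_mapL_comp_eq hYZ F x y hxy) (-i)
    rw [SheafHomology.homologyFunctor_map_subsetL, SheafHomology.homologyFunctor_map_subsetL] at h
    exact h
  · exact SheafHomology.homology_exact_last (hn i) (SheafHomology.mapL_comp_connectingL hYZ F).1
      (SheafHomology.mapL_comp_connectingL hYZ F).2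
      (fun _ x h₁ h₂ ↦ SheafHomology.exists_connectingL_comp_eq hYZ F x h₁ h₂)
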